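/- Let $d\ge 1$ and $M\ge 2$ be integers, let $\mathcal X\subset\mathbb R^d$ be a measurable set with non-empty interior (for example $[0,1]^d$ or $\mathbb R^d$), and let $0<\alpha\le 1$, $\beta>0$, $c_L>0$, $c_\beta\ge 1$ with $\alpha\beta<d$. For a probability distribution $\mathrm P$ of $(X,Y)$ on $\mathcal X\times\{1,\dots,M\}$ with $\pi_m=\mathrm P(Y=m)>0$ for all $m$, let $\eta_m(x)=\mathrm P(Y=m\mid X=x)$ and $$\eta^w_m(x)=\frac{\eta_m(x)/\pi_m}{\sum_{j=1}^M\eta_j(x)/\pi_j},$$ and let $\eta^w_{(1)}(x)\ge\eta^w_{(2)}(x)$ be the two largest of the numbers $\eta^w_1(x),\dots,\eta^w_M(x)$, counted with multiplicity. Let $\mathcal P$ be the set of all such $\mathrm P$ for which a version of $\eta$ satisfies (i) $|\eta_m(x')-\eta_m(x)|\le c_L\|x'-x\|^\alpha$ for all $x,x'\in\mathcal X$ and all $m$ (Hölder smoothness), and (ii) $\mathrm P\bigl(|\eta^w_{(1)}(X)-\eta^w_{(2)}(X)|\le t\bigr)\le c_\beta t^\beta$ for all $t>0$ (margin condition). For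 measurable $f:\mathbb R^d\to\mathbb R$ let $r_{\mathrm{AM}}(f)=\frac1M\sum_{m=1}^M\mathrm P(f(X)=m\mid Y=m)$ and let $\mathfrak R_{\mathrm{AM}}(f)=\sup_g r_{\mathrm{AM}}(g)-r_{\mathrm{AM}}(f)$ be its AM-regret, where the supremum is over all measurable $g:\mathbb R^d\to\{1,\dots,M\}$. Let $\mathcal F$ be the set of all measurable functions $f_n:(\mathbb R^d\times\mathbb R)^n\times\mathbb R^d\to\mathbb R$, and let $D_n$ be a sample of $n$ independent observations from $\mathrm P$. Then there is a constant $c>0$, independent of $n$, such that for all $n\ge 1$ $$\inf_{f_n\in\mathcal F}\ \sup_{\mathrm P\in\mathcal P}\ \mathbb E_{D_n\sim\mathrm P^n}\,\mathfrak R_{\mathrm{AM}}\bigl(f_n(D_n,\cdot)\bigr)\ \ge\ c\,n^{-\alpha(\beta+1)/(2\alpha+d)}.$$ Moreover, this bound does not rely on class proportions that degenerate as $n$ grows: there are numbers $p_1,\dots,p_M>0$, independent of $n$, such that the same bound (with some constant $c>0$ independent of $n$) holds with $\mathcal P$ replaced by its subset of all $\mathrm P$ with $\mathrm P(Y=m)=p_m$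 for all $m$. -/

import Mathlib

open MeasureTheory ProbabilityTheory

noncomputable section

namespace AMRegret

/-- The feature space `ℝ^d` with its Euclidean norm. -/
abbrev Feature (d : ℕ) : Type := EuclideanSpace ℝ (Fin d)

/-- The real number which codes a class: the elements of `Fin M` stand for the labels
`1, …, M`. -/
def label {M : ℕ} (m : Fin M) : ℝ := (m : ℝ) + 1

/-- The proportion `π_m = P(Y = m)` of the class `m`. -/
def classProb {d M : ℕ} (P : Measure (Feature d × Fin M)) (m : Fin M) : ℝ :=
  P.real {z | z.2 = m}

/-- The recall `r_m(f) = P(f(X) = m | Y = m)`. -/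
def classRecall {d M : ℕ} (P : Measure (Feature d × Fin M)) (f : Feature d → ℝ) (m : Fin M) : ℝ :=
  (P[|{z | z.2 = m}]).real {z | f z.1 = label m}

/-- The arithmetic mean of the recalls, `r_AM(f)`. -/
def amMeasure {d M : ℕ} (P : Measure (Feature d × Fin M)) (f : Feature d → ℝ) : ℝ :=
  (1 / (M : ℝ)) * ∑ m, classRecall P f m

/-- The optimal value `r_AM^*`: the supremum of `r_AM(f)` over all measurable
`f : ℝ^d → [M]`. All these numbers lie in `[0, 1]`. -/
def optimalAM {d M : ℕ} (P : Measure (Feature d × Fin M)) : ℝ :=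
  ⨆ f : {f : Feature d → Fin M // Measurable f}, amMeasure P (fun x => label (f.1 x))

/-- The AM-regret of `f`. -/
def amRegret {d M : ℕ} (P : Measure (Feature d × Fin M)) (f : Feature d → ℝ) : ℝ :=
  optimalAM P - amMeasure P f

/-- The posterior probability `η_m(x) = P(Y = m | X = x)` read off from a version `κ` of the
conditional distribution of `Y` given `X`. -/
def posterior {d M : ℕ} (κ : Kernel (Feature d) (Fin M)) (x : Feature d) (m : Fin M) : ℝ :=
  (κ x).real {m}

/-- The weighted posterior probability
`η^w_m(x) = (η_m(x) / π_m) / ∑_j η_j(x) / π_j`. -/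
def weightedPosterior {d M : ℕ} (P : Measure (Feature d × Fin M))
    (κ : Kernel (Feature d) (Fin M)) (x : Feature d) (m : Fin M) : ℝ :=
  (posterior κ x m / classProb P m) / ∑ j, posterior κ x j / classProb P j

/-- The `k`-th largest of the `M` numbers `v m`, counted with multiplicity, for `1 ≤ k ≤ M`:
the largest `t` such that at least `k` of the entries are `≥ t`. -/
def kthLargest {M : ℕ} (v : Fin M → ℝ) (k : ℕ) : ℝ :=
  sSup {t : ℝ | k ≤ (Finset.univ.filter fun m => t ≤ v m).card}

/-- Smoothness: the posterior probability function is `α`-Hölder continuous on `𝒳` with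
constant `cL` (with respect to the maximum norm on `ℝ^M`). -/
def HolderPosterior {d M : ℕ} (𝒳 : Set (Feature d)) (α cL : ℝ)
    (κ : Kernel (Feature d) (Fin M)) : Prop :=
  ∀ x ∈ 𝒳, ∀ x' ∈ 𝒳, ∀ m, |posterior κ x' m - posterior κ x m| ≤ cL * ‖x' - x‖ ^ α

/-- Margin: `P(|η^w_(1)(X) - η^w_(2)(X)| ≤ t) ≤ cβ t^β` for all `t > 0`. -/
def MarginCondition {d M : ℕ} (P : Measure (Feature d × Fin M)) (β cβ : ℝ)
    (κ : Kernel (Feature d) (Fin M)) : Prop :=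
  ∀ t : ℝ, 0 < t →
    P.real {z | |kthLargest (weightedPosterior P κ z.1) 1
      - kthLargest (weightedPosterior P κ z.1) 2| ≤ t} ≤ cβ * t ^ β

/-- The class `𝒫` of all probability distributions of `(X, Y)` on `𝒳 × [M]`, with
`P(Y = m) > 0` for every class `m`, which satisfy the smoothness and the margin assumption
(for some version of the conditional distribution of `Y` given `X`). -/
def distClass {d : ℕ} (M : ℕ) (𝒳 : Set (Feature d)) (α β cL cβ : ℝ) :
    Set (Measure (Feature d × Fin M)) :=
  {P | IsProbabilityMeasure P ∧ P.fst 𝒳ᶜ = 0 ∧ (∀ m, 0 < classProb P m) ∧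
    ∃ κ : Kernel (Feature d) (Fin M), IsMarkovKernel κ ∧ P.IsCondKernel κ ∧
      HolderPosterior 𝒳 α cL κ ∧ MarginCondition P β cβ κ}

/-- The expected AM-regret, under `n` independent observations `(X_i, Y_i)` from `P`, of the
classifier `x ↦ f_n((X_1, Y_1), …, (X_n, Y_n), x)`. -/
def expectedRegret {d M : ℕ} (P : Measure (Feature d × Fin M)) (n : ℕ)
    (f : (Fin n → Feature d × ℝ) × Feature d → ℝ) : ℝ :=
  ∫ D : Fin n → Feature d × Fin M,
    amRegret P (fun x => f (fun i => ((D i).1, label (D i).2), x)) ∂(Measure.pi fun _ => P)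

/-- The minimax AM-regret over a set `𝒬` of distributions: the infimum over all measurable
`f_n : (ℝ^d × ℝ)^n × ℝ^d → ℝ` of the worst expected AM-regret over `𝒬`. -/
def minimaxRegret {d M : ℕ} (𝒬 : Set (Measure (Feature d × Fin M))) (n : ℕ) : EReal :=
  ⨅ f : {f : (Fin n → Feature d × ℝ) × Feature d → ℝ // Measurable f},
    ⨆ P ∈ 𝒬, ((expectedRegret P n f.1 : ℝ) : EReal)

end AMRegret

end

/-! The bound is proved on distributions whose feature marginal has finitely many atoms inside `𝒳`,
so that recalls and expectations become finite sums. There are k^d cells of mesh of order 1/k, each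
carrying two atoms of mass w (total mass W = 2 k^d w), and one further atom per class, at constant
distance from all other atoms. At each atom only a base class `m₀` and one competitor may have
positive posterior. On the grid the competitor is `m₁`, with posterior b(1 ± a), a = k^(-α), where b
is the value at which the scores η_m/π_m of `m₀` and `m₁` agree. Hence the sign decides which class
is optimal, and a hidden pattern σ assigns one sign to each cell.

The two atoms of a cell carry opposite perturbations, so the class mass on the grid does not depend
on σ; the masses of the atoms of `m₀` and `m₁` absorb what depends on W. The class proportions are
therefore functions of ε and δ alone, fixed before k and n. Smoothness holds because an oscillation
of order k^(-α) occurs at distances of order 1/k, and a McShane extension supplies the posterior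
elsewhere (`exists_kernel_holder`). The gap of the weighted posteriors on the grid is at least a/3,
so the margin condition allows W = ε (a/3)^β (`Admissible.sum_margin_le`).

Flipping one sign lowers the Hellinger affinity of one observation by at most w a²
(`Admissible.le_affinity`). If n w a² ≤ 1/4, the inequalities of Le Cam and Assouad
(`sq_affinity_pow_le`, `sum_error_ge`) force errors at a constant fraction of the cells for some σ,
with a regret of order W a, that is k^(-α(β+1)). The choice k ≈ n^(1/s) with s = α(2+β)+d is
admissible, and as s ≥ 2α+d the resulting bound n^(-α(β+1)/s) dominates the claimed rate. -/

noncomputable section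

namespace AMRegret

/-! ### Finitely supported measures and their powers -/

section Atomic

/-- The measure with an atom of mass `g z` at each of the finitely many points `y z`. -/
def atomic {Z Ω : Type*} [Fintype Z] [MeasurableSpace Ω] (g : Z → ℝ) (y : Z → Ω) : Measure Ω :=
  ∑ z, ENNReal.ofReal (g z) • Measure.dirac (y z)

variable {Z Ω : Type*} [Fintype Z] [MeasurableSpace Ω] {g : Z → ℝ} {y : Z → Ω}

open Classical in
theorem atomic_apply [MeasurableSingletonClass Ω] (S : Set Ω) :
    atomic g y S = ∑ z, if y z ∈ S then ENNReal.ofReal (g z) else 0 := by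
  simp [atomic, Measure.finsetSum_apply, Set.indicator_apply]

instance [MeasurableSingletonClass Ω] : IsFiniteMeasure (atomic g y) := by
  constructor
  rw [atomic_apply]
  exact ENNReal.sum_lt_top.2 fun z _ => by split_ifs <;> simp

open Classical in
theorem atomic_real [MeasurableSingletonClass Ω] (hg : ∀ z, 0 ≤ g z) (S : Set Ω) :
    (atomic g y).real S = ∑ z, if y z ∈ S then g z else 0 := by
  rw [measureReal_def, atomic_apply, ENNReal.toReal_sum (fun z _ => by split_ifs <;> simp)]
  refine Finset.sum_congr rfl fun z _ => ?_
  split_ifs <;> simp [hg z]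

/-- Since singletons are measurable, every real function is integrable against a Dirac mass. The
regret can thus be integrated over samples without any measurability argument. -/
theorem integral_atomic [MeasurableSingletonClass Ω] (hg : ∀ z, 0 ≤ g z) (F : Ω → ℝ) :
    ∫ ω, F ω ∂(atomic g y) = ∑ z, g z * F (y z) := by
  rw [atomic, integral_finsetSum_measure]
  · refine Finset.sum_congr rfl fun z _ => ?_
    rw [integral_smul_measure, integral_dirac, ENNReal.toReal_ofReal (hg z), smul_eq_mul]
  · intro z _
    exact (integrable_dirac (by simp)).smul_measure (by simp)

theorem pi_atomic [MeasurableSingletonClass Ω] (hg : ∀ z, 0 ≤ g z) (n : ℕ) :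
    Measure.pi (fun _ : Fin n => atomic g y) =
      atomic (fun D : Fin n → Z => ∏ i, g (D i)) (fun D i => y (D i)) := by
  classical
  refine Measure.pi_eq fun s _ => ?_
  simp_rw [atomic_apply]
  rw [Finset.prod_univ_sum]
  refine Finset.sum_congr (by simp) fun D _ => ?_
  simp only [Set.mem_pi, Set.mem_univ, true_imp_iff]
  rw [ENNReal.ofReal_prod_of_nonneg (fun i _ => hg _)]
  by_cases h : ∀ i, y (D i) ∈ s i
  · simp [h]
  · rw [if_neg h]
    push Not at h
    obtain ⟨i, hi⟩ := h
    exact (Finset.prod_eq_zero (Finset.mem_univ i) (by simp [hi])).symm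

end Atomic

/-! ### Hölder extension of posterior probabilities -/

section Kernel

/-- Subadditivity of t ↦ t^α for 0 < α ≤ 1. It makes ‖y - y'‖^α a metric, which is what McShane's
extension needs. -/
theorem abs_rpow_sub_rpow_le {α u v : ℝ} (hα : 0 < α) (hα1 : α ≤ 1) (hu : 0 ≤ u) (hv : 0 ≤ v) :
    |u ^ α - v ^ α| ≤ |u - v| ^ α := by
  wlog h : v ≤ u generalizing u v
  · rw [abs_sub_comm, abs_sub_comm u v]
    exact this hv hu (le_of_not_ge h)
  rw [abs_of_nonneg (sub_nonneg.2 (Real.rpow_le_rpow hv h hα.le)), abs_of_nonneg (sub_nonneg.2 h)]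
  have := Real.rpow_add_le_add_rpow (sub_nonneg.2 h) hv hα.le hα1
  rw [sub_add_cancel] at this
  linarith

/-- McShane's extension of a nonnegative Hölder function from finitely many points. -/
theorem exists_holder_extension {E I : Type*} [NormedAddCommGroup E] [Fintype I] [Nonempty I]
    {α c V : ℝ} (hα : 0 < α) (hα1 : α ≤ 1) (hc : 0 ≤ c) (x : I → E) (v : I → ℝ)
    (hv : ∀ i, 0 ≤ v i) (hV : ∀ i, v i ≤ V)
    (h : ∀ i j, |v i - v j| ≤ c * ‖x i - x j‖ ^ α) :
    ∃ g : E → ℝ, (∀ y, 0 ≤ g y) ∧ (∀ y, g y ≤ V) ∧ (∀ i, g (x i) = v i) ∧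
      ∀ y y', |g y' - g y| ≤ c * ‖y' - y‖ ^ α := by
  have hpos : ∀ y : E, 0 ≤ c * ‖y‖ ^ α := fun y => by positivity
  have hne : (Finset.univ : Finset I).Nonempty := Finset.univ_nonempty
  -- Downward cones with apex v i at x i, truncated at 0 so that their maximum `g` stays between 0
  -- and V.
  let F : E → I → ℝ := fun y i => max 0 (v i - c * ‖y - x i‖ ^ α)
  let g : E → ℝ := fun y => Finset.univ.sup' hne (F y)
  have key : ∀ y y', g y' ≤ g y + c * ‖y' - y‖ ^ α := by
    intro y y'
    refine Finset.sup'_le _ _ fun i _ => ?_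
    have h1 : F y i ≤ g y := Finset.le_sup' (F y) (Finset.mem_univ i)
    have h2 : F y' i ≤ F y i + c * ‖y' - y‖ ^ α := by
      have h3 : ‖y - x i‖ ^ α ≤ ‖y' - x i‖ ^ α + ‖y' - y‖ ^ α := by
        have := abs_rpow_sub_rpow_le hα hα1 (norm_nonneg (y - x i)) (norm_nonneg (y' - x i))
        have h4 : |‖y - x i‖ - ‖y' - x i‖| ≤ ‖y' - y‖ := by
          have := abs_norm_sub_norm_le (y - x i) (y' - x i)
          rwa [sub_sub_sub_cancel_right, norm_sub_rev y y'] at this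
        have h5 := Real.rpow_le_rpow (abs_nonneg _) h4 hα.le
        have := le_abs_self (‖y - x i‖ ^ α - ‖y' - x i‖ ^ α)
        linarith
      have h6 := mul_le_mul_of_nonneg_left h3 hc
      have h7 := hpos (y' - y)
      refine max_le ?_ ?_
      · exact add_nonneg (le_max_left _ _) h7
      · have := le_max_right 0 (v i - c * ‖y - x i‖ ^ α)
        simp only [F]
        linarith
    linarith
  refine ⟨g, fun y => ?_, fun y => ?_, fun i => ?_, fun y y' => ?_⟩
  · obtain ⟨i⟩ := ‹Nonempty I›
    exact (le_max_left _ _).trans (Finset.le_sup' (F y) (Finset.mem_univ i))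
  · refine Finset.sup'_le _ _ fun i _ => max_le ((hv i).trans (hV i)) ?_
    linarith [hV i, hpos (y - x i)]
  · apply le_antisymm
    · refine Finset.sup'_le _ _ fun j _ => max_le (hv i) ?_
      have := (le_abs_self _).trans (h j i)
      rw [norm_sub_rev] at this
      linarith
    · refine le_trans ?_ (Finset.le_sup' (F (x i)) (Finset.mem_univ i))
      refine le_max_of_le_right ?_
      simp [hα.ne']
  · rw [abs_le]
    constructor
    · have := key y' y
      rw [norm_sub_rev] at this
      linarith
    · linarith [key y y']

theorem continuous_of_holder {E : Type*} [NormedAddCommGroup E] {α c : ℝ} (hα : 0 < α)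
    {g : E → ℝ} (h : ∀ y y', |g y' - g y| ≤ c * ‖y' - y‖ ^ α) : Continuous g := by
  rw [continuous_iff_continuousAt]
  intro y
  rw [ContinuousAt, tendsto_iff_dist_tendsto_zero]
  have hlim : Filter.Tendsto (fun y' => c * ‖y' - y‖ ^ α) (nhds y) (nhds 0) := by
    have : Continuous (fun y' => c * ‖y' - y‖ ^ α) :=
      continuous_const.mul ((continuous_id.sub continuous_const).norm.rpow_const
        fun _ => Or.inr hα.le)
    simpa [hα.ne'] using this.tendsto y
  exact squeeze_zero (fun _ => dist_nonneg) (fun y' => by rw [Real.dist_eq]; exact h y y') hlim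

theorem exists_kernel_of_posterior {d M : ℕ} (η : Feature d → Fin M → ℝ)
    (hη : ∀ m, Measurable fun x => η x m) (h0 : ∀ x m, 0 ≤ η x m) (h1 : ∀ x, ∑ m, η x m = 1) :
    ∃ κ : Kernel (Feature d) (Fin M), IsMarkovKernel κ ∧ ∀ x m, posterior κ x m = η x m := by
  classical
  have hmeas : Measurable fun x => atomic (η x) (id : Fin M → Fin M) := by
    refine Measure.measurable_of_measurable_coe _ fun s _ => ?_
    simp_rw [atomic_apply]
    refine Finset.measurable_sum _ fun m _ => ?_
    split_ifs
    · exact (hη m).ennreal_ofReal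
    · exact measurable_const
  refine ⟨⟨fun x => atomic (η x) id, hmeas⟩, ⟨fun x => ⟨?_⟩⟩, fun x m => ?_⟩
  · change atomic (η x) id Set.univ = 1
    rw [atomic_apply]
    simp [← ENNReal.ofReal_sum_of_nonneg (fun m _ => h0 x m), h1]
  · change (atomic (η x) id).real {m} = _
    rw [atomic_real (h0 x)]
    simp

/-- Conditional class probabilities prescribed at finitely many points extend to a Hölder
continuous posterior probability function. -/
theorem exists_kernel_holder {d M : ℕ} {I : Type*} [Fintype I] [Nonempty I] {α c V : ℝ}
    (hα : 0 < α) (hα1 : α ≤ 1) (hc : 0 ≤ c) (hV0 : 0 ≤ V) (hV1 : M * V ≤ 1) (m₀ : Fin M)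
    (x : I → Feature d) (q : I → Fin M → ℝ) (hq : ∀ i m, 0 ≤ q i m) (hq1 : ∀ i, ∑ m, q i m = 1)
    (hV : ∀ i m, m ≠ m₀ → q i m ≤ V)
    (h : ∀ i j m, m ≠ m₀ → |q i m - q j m| ≤ c * ‖x i - x j‖ ^ α) :
    ∃ κ : Kernel (Feature d) (Fin M), IsMarkovKernel κ ∧ (∀ i m, posterior κ (x i) m = q i m) ∧
      ∀ 𝒳, HolderPosterior 𝒳 α (M * c) κ := by
  classical
  have hex : ∀ m, ∃ g : Feature d → ℝ, m ≠ m₀ → (∀ y, 0 ≤ g y) ∧ (∀ y, g y ≤ V) ∧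
      (∀ i, g (x i) = q i m) ∧ ∀ y y', |g y' - g y| ≤ c * ‖y' - y‖ ^ α := by
    intro m
    by_cases hm : m = m₀
    · exact ⟨0, fun h => absurd hm h⟩
    · obtain ⟨g, hg⟩ := exists_holder_extension hα hα1 hc x (fun i => q i m) (fun i => hq i m)
        (fun i => hV i m hm) (fun i j => h i j m hm)
      exact ⟨g, fun _ => hg⟩
  choose g hg using hex
  let s : Finset (Fin M) := Finset.univ.erase m₀
  have hs : ∀ m ∈ s, m ≠ m₀ := fun m hm => Finset.ne_of_mem_erase hm
  -- The class m₀ takes the remainder. It is nonnegative because M V ≤ 1, and its Hölder constant is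
  -- at most M c as a sum of at most M increments.
  let η : Feature d → Fin M → ℝ := fun y m => if m = m₀ then 1 - ∑ j ∈ s, g j y else g m y
  have hcard : (s.card : ℝ) ≤ M := by
    have : s.card ≤ M := (Finset.card_le_univ s).trans (by simp)
    exact_mod_cast this
  have hcont : ∀ m, m ≠ m₀ → Continuous (g m) := fun m hm => continuous_of_holder hα (hg m hm).2.2.2
  have hsum : ∀ f : Fin M → ℝ, ∑ m, f m = f m₀ + ∑ m ∈ s, f m := fun f =>
    (Finset.add_sum_erase _ f (Finset.mem_univ m₀)).symm
  have hηs : ∀ y, ∑ m ∈ s, η y m = ∑ m ∈ s, g m y := fun y =>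
    Finset.sum_congr rfl fun m hm => by simp [η, hs m hm]
  obtain ⟨κ, hκ, hκη⟩ := exists_kernel_of_posterior η
    (fun m => by
      by_cases hm : m = m₀
      · simp only [η, hm, if_true]
        exact (continuous_const.sub
          (continuous_finsetSum _ fun j hj => hcont j (hs j hj))).measurable
      · simp only [η, hm, if_false]
        exact (hcont m hm).measurable)
    (fun y m => by
      by_cases hm : m = m₀
      · simp only [η, hm, if_true]
        have h1 : ∑ j ∈ s, g j y ≤ s.card • V :=
          Finset.sum_le_card_nsmul _ _ _ fun j hj => (hg j (hs j hj)).2.1 y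
        rw [nsmul_eq_mul] at h1
        nlinarith [mul_le_mul_of_nonneg_right hcard hV0]
      · simp only [η, hm, if_false]
        exact (hg m hm).1 y)
    (fun y => by
      rw [hsum, hηs]
      simp [η])
  refine ⟨κ, hκ, fun i m => ?_, fun 𝒳 y _ y' _ m => ?_⟩
  · rw [hκη]
    by_cases hm : m = m₀
    · subst hm
      simp only [η, if_true]
      have := hq1 i
      rw [hsum] at this
      rw [Finset.sum_congr rfl fun j hj => (hg j (hs j hj)).2.2.1 i]
      linarith
    · simp only [η, hm, if_false]
      exact (hg m hm).2.2.1 i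
  · rw [hκη, hκη]
    have hpos : 0 ≤ c * ‖y' - y‖ ^ α := by positivity
    have hM : (1 : ℝ) ≤ M := by
      have : 1 ≤ M := m₀.pos
      exact_mod_cast this
    by_cases hm : m = m₀
    · simp only [η, hm, if_true]
      have : (1 - ∑ j ∈ s, g j y') - (1 - ∑ j ∈ s, g j y) = -∑ j ∈ s, (g j y' - g j y) := by
        rw [Finset.sum_sub_distrib]; ring
      rw [this, abs_neg]
      calc |∑ j ∈ s, (g j y' - g j y)| ≤ ∑ j ∈ s, |g j y' - g j y| := Finset.abs_sum_le_sum_abs _ _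
        _ ≤ s.card • (c * ‖y' - y‖ ^ α) :=
          Finset.sum_le_card_nsmul _ _ _ fun j hj => (hg j (hs j hj)).2.2.2 y y'
        _ ≤ M * c * ‖y' - y‖ ^ α := by
          rw [nsmul_eq_mul, mul_assoc]
          exact mul_le_mul_of_nonneg_right hcard hpos
    · simp only [η, hm, if_false]
      refine ((hg m hm).2.2.2 y y').trans ?_
      rw [mul_assoc]
      nlinarith

theorem atomic_compProd {d M : ℕ} {I : Type*} [Fintype I] {w : I → ℝ} (hw : ∀ i, 0 ≤ w i)
    (x : I → Feature d) (κ : Kernel (Feature d) (Fin M)) [IsMarkovKernel κ] :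
    (atomic w x) ⊗ₘ κ =
      atomic (fun z : I × Fin M => w z.1 * posterior κ (x z.1) z.2) (fun z => (x z.1, z.2)) := by
  classical
  ext s hs
  rw [Measure.compProd_apply hs, atomic_apply, Fintype.sum_prod_type, atomic,
    lintegral_finsetSum_measure]
  refine Finset.sum_congr rfl fun i _ => ?_
  rw [lintegral_smul_measure, lintegral_dirac, smul_eq_mul]
  have : Prod.mk (x i) ⁻¹' s = ↑(Finset.univ.filter fun m : Fin M => (x i, m) ∈ s) := by
    ext; simp
  rw [this, ← sum_measure_singleton, Finset.mul_sum, Finset.sum_filter]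
  refine Finset.sum_congr rfl fun m _ => ?_
  split_ifs
  · rw [ENNReal.ofReal_mul (hw i), posterior, ofReal_measureReal]
  · rfl

end Kernel

/-! ### Two-point testing and Hellinger affinity -/

section Testing

/-- Le Cam's inequality: the sum of the two error probabilities of a test is bounded below by
the Hellinger affinity. -/
theorem sq_affinity_le {D : Type*} [Fintype D] (p q φ ψ : D → ℝ) (hp : ∀ z, 0 ≤ p z)
    (hq : ∀ z, 0 ≤ q z) (hp1 : ∑ z, p z = 1) (hq1 : ∑ z, q z = 1) (hφ : ∀ z, 0 ≤ φ z)
    (hψ : ∀ z, 0 ≤ ψ z) (h : ∀ z, 1 ≤ φ z + ψ z) :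
    (∑ z, √(p z * q z)) ^ 2 / 2 ≤ ∑ z, p z * φ z + ∑ z, q z * ψ z := by
  -- Cauchy–Schwarz, using p q = min(p, q) · max(p, q).
  have h1 : (∑ z, √(p z * q z)) ^ 2 ≤ (∑ z, min (p z) (q z)) * ∑ z, max (p z) (q z) := by
    refine Finset.sum_sq_le_sum_mul_sum_of_sq_le_mul _ (fun z _ => le_min (hp z) (hq z))
      (fun z _ => (hp z).trans (le_max_left _ _)) fun z _ => ?_
    rw [Real.sq_sqrt (mul_nonneg (hp z) (hq z)), min_mul_max]
  have h2 : ∑ z, max (p z) (q z) ≤ 2 := by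
    calc ∑ z, max (p z) (q z) ≤ ∑ z, (p z + q z) :=
          Finset.sum_le_sum fun z _ => max_le (by linarith [hq z]) (by linarith [hp z])
      _ = 2 := by rw [Finset.sum_add_distrib, hp1, hq1]; norm_num
  have h3 : 0 ≤ ∑ z, min (p z) (q z) := Finset.sum_nonneg fun z _ => le_min (hp z) (hq z)
  have h4 : ∑ z, min (p z) (q z) ≤ ∑ z, p z * φ z + ∑ z, q z * ψ z := by
    rw [← Finset.sum_add_distrib]
    refine Finset.sum_le_sum fun z _ => ?_
    have a1 := mul_le_mul_of_nonneg_right (min_le_left (p z) (q z)) (hφ z)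
    have a2 := mul_le_mul_of_nonneg_right (min_le_right (p z) (q z)) (hψ z)
    have a3 := mul_le_mul_of_nonneg_left (h z) (le_min (hp z) (hq z))
    linarith
  nlinarith [mul_le_mul_of_nonneg_left h2 h3]

theorem sum_prod_eq_pow {Z : Type*} [Fintype Z] (n : ℕ) (g : Z → ℝ) :
    ∑ D : Fin n → Z, ∏ i, g (D i) = (∑ z, g z) ^ n := by
  classical
  rw [← Finset.card_fin n, ← Finset.prod_const, Finset.card_fin, Finset.prod_univ_sum]
  simp

/-- The affinity is multiplicative over independent observations; squaring it in Le Cam's inequality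
gives the exponent 2n. -/
theorem sq_affinity_pow_le {Z : Type*} [Fintype Z] (n : ℕ) (p q : Z → ℝ)
    (φ ψ : (Fin n → Z) → ℝ) (hp : ∀ z, 0 ≤ p z) (hq : ∀ z, 0 ≤ q z) (hp1 : ∑ z, p z = 1)
    (hq1 : ∑ z, q z = 1) (hφ : ∀ z, 0 ≤ φ z) (hψ : ∀ z, 0 ≤ ψ z) (h : ∀ z, 1 ≤ φ z + ψ z) :
    (∑ z, √(p z * q z)) ^ (2 * n) / 2 ≤
      ∑ D, (∏ i, p (D i)) * φ D + ∑ D, (∏ i, q (D i)) * ψ D := by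
  have := sq_affinity_le (fun D : Fin n → Z => ∏ i, p (D i)) (fun D => ∏ i, q (D i)) φ ψ
    (fun D => Finset.prod_nonneg fun i _ => hp _) (fun D => Finset.prod_nonneg fun i _ => hq _)
    (by rw [sum_prod_eq_pow, hp1, one_pow]) (by rw [sum_prod_eq_pow, hq1, one_pow]) hφ hψ h
  rw [mul_comm, pow_mul, ← sum_prod_eq_pow]
  convert this using 5 with D
  rw [← Finset.prod_mul_distrib, Real.sqrt_prod _ fun i _ => mul_nonneg (hp _) (hq _)]

end Testing

/-! ### The two largest entries -/

section KthLargest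

/-- The thresholds reached by at least one entry, respectively two entries, form closed half-lines
ending at v a and v b. -/
theorem kthLargest_one_two {M : ℕ} {v : Fin M → ℝ} {a b : Fin M} (hab : a ≠ b)
    (h1 : v b ≤ v a) (h2 : ∀ m, m ≠ a → v m ≤ v b) :
    kthLargest v 1 = v a ∧ kthLargest v 2 = v b := by
  constructor
  · have : {t : ℝ | 1 ≤ (Finset.univ.filter fun m => t ≤ v m).card} = Set.Iic (v a) := by
      ext t
      simp only [Set.mem_ofPred_eq, Set.mem_Iic, Finset.one_le_card]
      constructor
      · rintro ⟨m, hm⟩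
        simp only [Finset.mem_filter_univ] at hm
        by_cases hma : m = a
        · exact hma ▸ hm
        · exact hm.trans ((h2 m hma).trans h1)
      · exact fun h => ⟨a, by simpa using h⟩
    rw [kthLargest, this, csSup_Iic]
  · have : {t : ℝ | 2 ≤ (Finset.univ.filter fun m => t ≤ v m).card} = Set.Iic (v b) := by
      ext t
      simp only [Set.mem_ofPred_eq, Set.mem_Iic]
      constructor
      · intro h
        obtain ⟨m, hm, hma⟩ := Finset.exists_mem_ne h a
        simp only [Finset.mem_filter_univ] at hm
        exact hm.trans (h2 m hma)
      · intro h
        have : ({a, b} : Finset (Fin M)) ⊆ Finset.univ.filter fun m => t ≤ v m := by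
          intro m hm
          simp only [Finset.mem_insert, Finset.mem_singleton] at hm
          rcases hm with rfl | rfl
          · simpa using h.trans h1
          · simpa using h
        rw [← Finset.card_pair hab]
        exact Finset.card_le_card this
    rw [kthLargest, this, csSup_Iic]

end KthLargest

/-! ### AM measure and regret of atomic distributions -/

section AtomicDistribution

theorem label_injective {M : ℕ} : Function.Injective (label : Fin M → ℝ) := by
  intro a b h
  simp only [label, add_left_inj, Nat.cast_inj] at h
  exact Fin.ext h

theorem amMeasure_le_one {d M : ℕ} (P : Measure (Feature d × Fin M)) [IsFiniteMeasure P]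
    (f : Feature d → ℝ) : amMeasure P f ≤ 1 := by
  have h : ∑ m, classRecall P f m ≤ ∑ _m : Fin M, (1 : ℝ) :=
    Finset.sum_le_sum fun m _ => measureReal_le_one
  simp only [Finset.sum_const, Finset.card_univ, Fintype.card_fin, nsmul_eq_mul, mul_one] at h
  rw [amMeasure, one_div_mul_eq_div]
  exact div_le_one_of_le₀ h (Nat.cast_nonneg M)

theorem le_optimalAM {d M : ℕ} (P : Measure (Feature d × Fin M)) [IsFiniteMeasure P]
    {g : Feature d → Fin M} (hg : Measurable g) :
    amMeasure P (fun x => label (g x)) ≤ optimalAM P :=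
  le_ciSup (f := fun f : {f : Feature d → Fin M // Measurable f} =>
    amMeasure P (fun x => label (f.1 x)))
    ⟨1, by rintro _ ⟨f, rfl⟩; exact amMeasure_le_one P _⟩ ⟨g, hg⟩

theorem exists_measurable_extend {d M : ℕ} {I : Type*} [Fintype I] [Nonempty I]
    {x : I → Feature d} (hx : Function.Injective x) (c : I → Fin M) :
    ∃ g : Feature d → Fin M, Measurable g ∧ ∀ i, g (x i) = c i := by
  obtain ⟨i₀⟩ := ‹Nonempty I›
  refine ⟨Function.extend x c fun _ => c i₀, ?_, fun i => hx.extend_apply _ _ i⟩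
  refine measurable_of_measurable_on_compl_finite (Set.range x) (Set.finite_range x) ?_
  have : (Set.range x)ᶜ.domRestrict (Function.extend x c fun _ => c i₀) = fun _ => c i₀ := by
    ext1 y
    exact Function.extend_apply' _ _ _ y.2
  rw [this]
  exact measurable_const

theorem mul_posterior_nonneg {d M : ℕ} {I : Type*} {w : I → ℝ} {x : I → Feature d}
    {κ : Kernel (Feature d) (Fin M)} (hw : ∀ i, 0 ≤ w i) (z : I × Fin M) :
    0 ≤ w z.1 * posterior κ (x z.1) z.2 := mul_nonneg (hw _) measureReal_nonneg

theorem sum_posterior {d M : ℕ} {κ : Kernel (Feature d) (Fin M)} [IsMarkovKernel κ]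
    (y : Feature d) : ∑ m, posterior κ y m = 1 := by
  simp only [posterior]
  rw [sum_measureReal_singleton]
  simp

variable {d M : ℕ} {I : Type*} [Fintype I] {w : I → ℝ} {x : I → Feature d}
  {κ : Kernel (Feature d) (Fin M)} [IsMarkovKernel κ]

open Classical in
theorem compProd_real (hw : ∀ i, 0 ≤ w i) (S : Set (Feature d × Fin M)) :
    ((atomic w x) ⊗ₘ κ).real S =
      ∑ i, ∑ m, if (x i, m) ∈ S then w i * posterior κ (x i) m else 0 := by
  rw [atomic_compProd hw, atomic_real (mul_posterior_nonneg hw), Fintype.sum_prod_type]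

theorem classProb_compProd (hw : ∀ i, 0 ≤ w i) (m : Fin M) :
    classProb ((atomic w x) ⊗ₘ κ) m = ∑ i, w i * posterior κ (x i) m := by
  classical
  rw [classProb, compProd_real hw]
  refine Finset.sum_congr rfl fun i _ => ?_
  rw [Finset.sum_eq_single m]
  · simp
  · intro m' _ hm'
    simp [hm']
  · simp

theorem isProbabilityMeasure_compProd (hw : ∀ i, 0 ≤ w i) (hw1 : ∑ i, w i = 1) :
    IsProbabilityMeasure ((atomic w x) ⊗ₘ κ) := by
  classical
  constructor
  have : ((atomic w x) ⊗ₘ κ).real Set.univ = 1 := by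
    rw [compProd_real hw]
    simp [← Finset.mul_sum, sum_posterior, hw1]
  rw [← ofReal_measureReal, this, ENNReal.ofReal_one]

-- Exchanging the sums turns the mean recall into a weighted classification problem: answering m at
-- an atom earns the score posterior / proportion of m there.
open Classical in
theorem amMeasure_compProd (hw : ∀ i, 0 ≤ w i) (f : Feature d → ℝ) :
    amMeasure ((atomic w x) ⊗ₘ κ) f = 1 / (M : ℝ) * ∑ i, w i * ∑ m,
      if f (x i) = label m then
        posterior κ (x i) m / classProb ((atomic w x) ⊗ₘ κ) m else 0 := by
  rw [amMeasure]
  congr 1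
  simp_rw [Finset.mul_sum]
  rw [Finset.sum_comm]
  refine Finset.sum_congr rfl fun m _ => ?_
  have hm : MeasurableSet {z : Feature d × Fin M | z.2 = m} :=
    measurable_snd (measurableSet_singleton m)
  rw [classRecall, measureReal_def, cond_apply hm, ENNReal.toReal_mul, ENNReal.toReal_inv,
    ← measureReal_def, ← measureReal_def,
    show ((atomic w x) ⊗ₘ κ).real {z | z.2 = m} = classProb ((atomic w x) ⊗ₘ κ) m from rfl,
    compProd_real hw, Finset.mul_sum]
  refine Finset.sum_congr rfl fun i _ => ?_
  rw [Finset.sum_eq_single m]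
  · by_cases h : f (x i) = label m
    · simp [h]; ring
    · simp [h]
  · intro m' _ hm'
    simp [hm']
  · simp

open Classical in
theorem expectedRegret_compProd (hw : ∀ i, 0 ≤ w i) (n : ℕ)
    (f : (Fin n → Feature d × ℝ) × Feature d → ℝ) :
    expectedRegret ((atomic w x) ⊗ₘ κ) n f = ∑ D : Fin n → I × Fin M,
      (∏ i, w (D i).1 * posterior κ (x (D i).1) (D i).2) * amRegret ((atomic w x) ⊗ₘ κ)
        (fun y => f (fun i => (x (D i).1, label (D i).2), y)) := by
  rw [expectedRegret]
  have h := atomic_compProd hw x κ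
  rw [show (fun _ : Fin n => (atomic w x) ⊗ₘ κ) = fun _ => atomic
    (fun z : I × Fin M => w z.1 * posterior κ (x z.1) z.2) (fun z => (x z.1, z.2)) from
      funext fun _ => h, pi_atomic (mul_posterior_nonneg hw), integral_atomic]
  exact fun D => Finset.prod_nonneg fun i _ => mul_posterior_nonneg hw _

end AtomicDistribution

/-! ### Atoms with two competing classes -/

section TwoClass

/-- The probability vector which gives mass `v` to the class `t` and the rest to `m₀`. -/
def twoClass {M : ℕ} (m₀ t : Fin M) (v : ℝ) (m : Fin M) : ℝ :=
  if m = m₀ then 1 - v else if m = t then v else 0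

theorem sum_twoClass_mul {M : ℕ} {m₀ t : Fin M} (ht : t ≠ m₀) (v : ℝ) (f : Fin M → ℝ) :
    ∑ m, twoClass m₀ t v m * f m = (1 - v) * f m₀ + v * f t := by
  have : ∀ m, twoClass m₀ t v m * f m =
      (if m = m₀ then (1 - v) * f m else 0) + if m = t then v * f m else 0 := by
    intro m
    by_cases h : m = m₀
    · subst h
      simp [twoClass, ht.symm]
    · by_cases h' : m = t <;> simp [twoClass, h, h', ht]
  simp_rw [this]
  rw [Finset.sum_add_distrib]
  simp

theorem sum_twoClass {M : ℕ} {m₀ t : Fin M} (ht : t ≠ m₀) (v : ℝ) :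
    ∑ m, twoClass m₀ t v m = 1 := by
  have := sum_twoClass_mul ht v fun _ => 1
  simpa using this

theorem twoClass_nonneg {M : ℕ} (m₀ t : Fin M) {v : ℝ} (h0 : 0 ≤ v) (h1 : v ≤ 1) (m : Fin M) :
    0 ≤ twoClass m₀ t v m := by
  unfold twoClass
  split_ifs <;> linarith

theorem twoClass_self {M : ℕ} (m₀ t : Fin M) (v : ℝ) : twoClass m₀ t v m₀ = 1 - v := by
  simp [twoClass]

theorem twoClass_target {M : ℕ} {m₀ t : Fin M} (ht : t ≠ m₀) (v : ℝ) :
    twoClass m₀ t v t = v := by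
  simp [twoClass, ht]

theorem gap_two {M : ℕ} {u : Fin M → ℝ} {a b : Fin M} (hab : a ≠ b) (ha : 0 ≤ u a) (hb : 0 ≤ u b)
    (h0 : ∀ m, m ≠ a → m ≠ b → u m = 0) :
    |kthLargest u 1 - kthLargest u 2| = |u a - u b| := by
  rcases le_total (u b) (u a) with h | h
  · obtain ⟨h1, h2⟩ := kthLargest_one_two hab h fun m hm => by
      by_cases hmb : m = b
      · rw [hmb]
      · rw [h0 m hm hmb]; exact hb
    rw [h1, h2]
  · obtain ⟨h1, h2⟩ := kthLargest_one_two hab.symm h fun m hm => by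
      by_cases hma : m = a
      · rw [hma]
      · rw [h0 m hma hm]; exact ha
    rw [h1, h2, abs_sub_comm]

theorem gap_weightedPosterior {d M : ℕ} {I : Type*} {x : I → Feature d}
    {κ : Kernel (Feature d) (Fin M)} {m₀ : Fin M} {t : I → Fin M} {v : I → ℝ} {p : Fin M → ℝ}
    (P : Measure (Feature d × Fin M)) (i : I) (ht : t i ≠ m₀)
    (hp : ∀ m, 0 < p m) (hP : ∀ m, classProb P m = p m) (h0 : 0 ≤ v i) (h1 : v i ≤ 1)
    (hκ : ∀ m, posterior κ (x i) m = twoClass m₀ (t i) (v i) m) :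
    |kthLargest (weightedPosterior P κ (x i)) 1 - kthLargest (weightedPosterior P κ (x i)) 2| =
      |(1 - v i) / p m₀ - v i / p (t i)| / ((1 - v i) / p m₀ + v i / p (t i)) := by
  have hS : ∑ j, posterior κ (x i) j / classProb P j = (1 - v i) / p m₀ + v i / p (t i) := by
    simp_rw [hκ, hP, div_eq_mul_inv]
    exact sum_twoClass_mul ht _ fun m => (p m)⁻¹
  have hS0 : 0 ≤ (1 - v i) / p m₀ + v i / p (t i) :=
    add_nonneg (div_nonneg (by linarith) (hp _).le) (div_nonneg h0 (hp _).le)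
  have hw : ∀ m, weightedPosterior P κ (x i) m =
      twoClass m₀ (t i) (v i) m / p m / ((1 - v i) / p m₀ + v i / p (t i)) := fun m => by
    rw [weightedPosterior, hS, hκ, hP]
  have hnn : ∀ m, 0 ≤ weightedPosterior P κ (x i) m := fun m => by
    rw [hw]
    exact div_nonneg (div_nonneg (twoClass_nonneg _ _ h0 h1 _) (hp _).le) hS0
  rw [gap_two ht.symm (hnn _) (hnn _), hw, hw, twoClass_self, twoClass_target ht, ← sub_div, abs_div,
    abs_of_nonneg hS0]
  intro m h1 h2
  rw [hw]
  simp [twoClass, h1, h2]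

variable {d M : ℕ} {I : Type*} [Fintype I] {w : I → ℝ} {x : I → Feature d}
  {κ : Kernel (Feature d) (Fin M)} [IsMarkovKernel κ] {m₀ : Fin M} {t : I → Fin M} {v : I → ℝ}
  {p : Fin M → ℝ}

theorem margin_real (hw : ∀ i, 0 ≤ w i) (G : Feature d → ℝ) (s : ℝ) :
    ((atomic w x) ⊗ₘ κ).real {z | G z.1 ≤ s} = ∑ i, if G (x i) ≤ s then w i else 0 := by
  classical
  rw [compProd_real hw]
  refine Finset.sum_congr rfl fun i _ => ?_
  by_cases h : G (x i) ≤ s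
  · simp [h, ← Finset.mul_sum, sum_posterior]
  · simp [h]

-- The supremum is bounded below by one classifier, which picks the larger score at each atom and
-- `m₀` in case of a tie. A value of f that is neither of the two labels forfeits the whole larger
-- score, which is at least the difference of the scores.
open Classical in
theorem le_amRegret_compProd [Nonempty I] (hw : ∀ i, 0 ≤ w i) (hx : Function.Injective x)
    (ht : ∀ i, t i ≠ m₀) (hp : ∀ m, 0 < p m)
    (hP : ∀ m, classProb ((atomic w x) ⊗ₘ κ) m = p m) (h0 : ∀ i, 0 ≤ v i) (h1 : ∀ i, v i ≤ 1)
    (hκ : ∀ i m, posterior κ (x i) m = twoClass m₀ (t i) (v i) m) (f : Feature d → ℝ) :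
    1 / (M : ℝ) * ∑ i, w i * (|(1 - v i) / p m₀ - v i / p (t i)| *
      if f (x i) = label (if v i / p (t i) ≤ (1 - v i) / p m₀ then m₀ else t i) then 0 else 1) ≤
      amRegret ((atomic w x) ⊗ₘ κ) f := by
  obtain ⟨g, hg, hgx⟩ := exists_measurable_extend hx
    fun i => if v i / p (t i) ≤ (1 - v i) / p m₀ then m₀ else t i
  have hopt := le_optimalAM ((atomic w x) ⊗ₘ κ) hg
  refine le_trans ?_ (sub_le_sub_right hopt _)
  rw [amMeasure_compProd hw, amMeasure_compProd hw, ← mul_sub, ← Finset.sum_sub_distrib]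
  refine mul_le_mul_of_nonneg_left (Finset.sum_le_sum fun i _ => ?_) (by positivity)
  rw [← mul_sub]
  refine mul_le_mul_of_nonneg_left ?_ (hw i)
  have hsum : ∀ y : ℝ, ∑ m, (if y = label m then
      posterior κ (x i) m / classProb ((atomic w x) ⊗ₘ κ) m else 0) =
      (if y = label m₀ then (1 - v i) / p m₀ else 0) +
        if y = label (t i) then v i / p (t i) else 0 := by
    intro y
    have := sum_twoClass_mul (ht i) (v i) fun m => if y = label m then (p m)⁻¹ else 0
    simp only [mul_ite, mul_zero] at this
    simp_rw [hκ, hP, div_eq_mul_inv]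
    exact this
  rw [hsum, hsum, hgx]
  have hA : 0 ≤ (1 - v i) / p m₀ := div_nonneg (by linarith [h1 i]) (hp _).le
  have hC : 0 ≤ v i / p (t i) := div_nonneg (h0 i) (hp _).le
  set A := (1 - v i) / p m₀
  set C := v i / p (t i)
  have hti := ht i
  have hl : label (t i) ≠ label m₀ := fun h => hti (label_injective h)
  by_cases h : C ≤ A
  · simp only [h, if_true]
    rw [abs_of_nonneg (sub_nonneg.2 h)]
    by_cases h2 : f (x i) = label m₀
    · simp [h2, hl.symm]
    · by_cases h3 : f (x i) = label (t i)
      · simp [h3, hl, hl.symm]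
      · simp [h2, h3, hl.symm, hC]
  · simp only [h, if_false]
    rw [abs_of_nonpos (by linarith)]
    by_cases h2 : f (x i) = label m₀
    · simp [h2, hl, hl.symm]
    · by_cases h3 : f (x i) = label (t i)
      · simp [h3, hl]
      · simp [h2, h3, hl, hA]

end TwoClass

/-! ### Separated atoms inside the domain -/

section Geometry

/-- The positions of the atoms in the unit of the construction: a fine grid with two points in
each cell, and one point for each class on the diagonal. -/
def gridPoint {d k M : ℕ} : ((Fin d → Fin k) × Bool) ⊕ Fin M → Fin d → ℝ
  | .inl (j, s), i => ((j i : ℝ) + if s then 1 / 2 else 0) / k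
  | .inr m, _ => 2 + (m : ℝ)

theorem gridPoint_inl_mem {d k M : ℕ} (z : (Fin d → Fin k) × Bool) (i : Fin d) :
    0 ≤ gridPoint (M := M) (.inl z) i ∧ gridPoint (M := M) (.inl z) i ≤ 1 := by
  obtain ⟨j, s⟩ := z
  have hk : (0 : ℝ) < k := by exact_mod_cast (j i).pos
  have hj : (j i : ℝ) + 1 ≤ k := by exact_mod_cast (j i).isLt
  have hs : (0 : ℝ) ≤ (if s then 1 / 2 else 0) ∧ (if s then 1 / 2 else 0 : ℝ) ≤ 1 := by
    split_ifs <;> norm_num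
  have : (0 : ℝ) ≤ j i := Nat.cast_nonneg _
  simp only [gridPoint]
  exact ⟨div_nonneg (by linarith) hk.le, (div_le_one hk).2 (by linarith)⟩

theorem abs_gridPoint_le {d k M : ℕ} (z : ((Fin d → Fin k) × Bool) ⊕ Fin M) (i : Fin d) :
    |gridPoint z i| ≤ M + 2 := by
  rcases z with z | m
  · obtain ⟨h0, h1⟩ := gridPoint_inl_mem (M := M) z i
    rw [abs_of_nonneg h0]
    have : (0 : ℝ) ≤ M := Nat.cast_nonneg _
    linarith
  · have : (m : ℝ) ≤ M := by exact_mod_cast m.isLt.le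
    have h0 : (0 : ℝ) ≤ m := Nat.cast_nonneg _
    simp only [gridPoint]
    rw [abs_of_nonneg (by linarith)]
    linarith

theorem one_le_abs_gridPoint_sub {d k M : ℕ} {z z' : ((Fin d → Fin k) × Bool) ⊕ Fin M}
    (h : z ≠ z') (hz : z.isRight) (i : Fin d) : 1 ≤ |gridPoint z i - gridPoint z' i| := by
  rcases z with z | m
  · simp at hz
  rcases z' with z' | m'
  · obtain ⟨h0, h1⟩ := gridPoint_inl_mem (M := M) z' i
    have : (0 : ℝ) ≤ m := Nat.cast_nonneg _
    have h2 : gridPoint (d := d) (k := k) (.inr m) i = 2 + (m : ℝ) := rfl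
    rw [h2]
    refine le_trans ?_ (le_abs_self _)
    linarith
  · have hne : (m : ℤ) - (m' : ℤ) ≠ 0 := by
      intro h'
      apply h
      have : (m : ℕ) = m' := by omega
      rw [Fin.ext this]
    have h1 := Int.one_le_abs hne
    have h2 : (1 : ℝ) ≤ |(m : ℝ) - m'| := by exact_mod_cast h1
    simpa [gridPoint] using h2

theorem exists_gridPoint_sub {d k M : ℕ} (hd : 1 ≤ d) (hk : 1 ≤ k)
    {z z' : (Fin d → Fin k) × Bool} (h : z ≠ z') :
    ∃ i, 1 / 2 / (k : ℝ) ≤ |gridPoint (M := M) (.inl z) i - gridPoint (M := M) (.inl z') i| := by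
  obtain ⟨j, s⟩ := z
  obtain ⟨j', s'⟩ := z'
  have hk0 : (0 : ℝ) < k := by exact_mod_cast hk
  -- In units of 1/(2k) the coordinates are the integers 2j + s; parity recovers s, and then j.
  have key : ∃ i, (2 * (j i : ℤ) + if s then 1 else 0) - (2 * (j' i : ℤ) + if s' then 1 else 0) ≠ 0 := by
    by_contra! hcon
    apply h
    have hs : s = s' := by
      have := hcon ⟨0, hd⟩
      cases s <;> cases s' <;> simp at this ⊢ <;> omega
    subst hs
    have hj : j = j' := by
      funext i
      have := hcon i
      exact Fin.ext (by omega)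
    rw [hj]
  obtain ⟨i, hi⟩ := key
  refine ⟨i, ?_⟩
  have h1 := Int.one_le_abs hi
  have h2 : (1 : ℝ) ≤ |(2 * (j i : ℝ) + if s then 1 else 0) - (2 * (j' i : ℝ) + if s' then 1 else 0)| := by
    exact_mod_cast h1
  have h3 : gridPoint (M := M) (.inl (j, s)) i - gridPoint (M := M) (.inl (j', s')) i =
      ((2 * (j i : ℝ) + if s then 1 else 0) - (2 * (j' i : ℝ) + if s' then 1 else 0)) / (2 * k) := by
    simp only [gridPoint]
    cases s <;> cases s' <;> simp <;> field_simp <;> ring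
  rw [h3, abs_div, abs_of_pos (by positivity : (0 : ℝ) < 2 * k), div_div]
  exact div_le_div_of_nonneg_right h2 (by positivity)

/-- Atoms inside `𝒳`: those of the grid of mesh `1 / k` have mutual distances of order `1 / k`,
the others are at constant distance from all atoms. -/
theorem exists_separated_points {d : ℕ} (M : ℕ) (hd : 1 ≤ d) {𝒳 : Set (Feature d)}
    (h𝒳 : (interior 𝒳).Nonempty) :
    ∃ r : ℝ, 0 < r ∧ ∀ k : ℕ, 1 ≤ k → ∃ x : ((Fin d → Fin k) × Bool) ⊕ Fin M → Feature d,
      (∀ z, x z ∈ 𝒳) ∧ (∀ z z', z ≠ z' → r / k ≤ ‖x z - x z'‖) ∧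
      ∀ z z', z ≠ z' → z.isRight → r ≤ ‖x z - x z'‖ := by
  obtain ⟨x₀, hx₀⟩ := h𝒳
  obtain ⟨R, hR, hball⟩ := Metric.mem_nhds_iff.1 (mem_interior_iff_mem_nhds.1 hx₀)
  have hd0 : (0 : ℝ) < d := by exact_mod_cast hd
  have hM : (0 : ℝ) ≤ M := Nat.cast_nonneg _
  -- Grid and class points have norm at most d(M+2), so this scale places all atoms within R/2 of
  -- x₀.
  set s : ℝ := R / (2 * (d * (M + 2))) with hs
  have hs0 : 0 < s := by positivity
  refine ⟨s / 2, by positivity, fun k hk => ?_⟩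
  have hk1 : (1 : ℝ) ≤ k := by exact_mod_cast hk
  let x : ((Fin d → Fin k) × Bool) ⊕ Fin M → Feature d := fun z =>
    x₀ + s • WithLp.toLp 2 (gridPoint z)
  have hdist : ∀ z z' i, s * |gridPoint z i - gridPoint z' i| ≤ ‖x z - x z'‖ := by
    intro z z' i
    have h1 := PiLp.norm_apply_le (x z - x z') i
    have h2 : (x z - x z') i = s * (gridPoint z i - gridPoint z' i) := by
      simp [x]; ring
    rwa [h2, Real.norm_eq_abs, abs_mul, abs_of_pos hs0] at h1
  have hright : ∀ z z', z ≠ z' → z.isRight → s / 2 ≤ ‖x z - x z'‖ := by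
    intro z z' h hz
    have h1 := hdist z z' ⟨0, hd⟩
    have h2 := one_le_abs_gridPoint_sub h hz ⟨0, hd⟩
    nlinarith
  refine ⟨x, fun z => ?_, fun z z' h => ?_, hright⟩
  · apply hball
    rw [mem_ball_iff_norm, add_sub_cancel_left, norm_smul, Real.norm_eq_abs, abs_of_pos hs0]
    have h1 : ‖(WithLp.toLp 2 (gridPoint z) : Feature d)‖ ≤ d * (M + 2) := by
      refine abs_le_of_sq_le_sq' ?_ (by positivity) |>.2
      rw [EuclideanSpace.norm_sq_eq]
      calc ∑ i, ‖(WithLp.toLp 2 (gridPoint z) : Feature d) i‖ ^ 2 ≤ ∑ _i : Fin d, ((M : ℝ) + 2) ^ 2 :=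
            Finset.sum_le_sum fun i _ =>
              pow_le_pow_left₀ (norm_nonneg _) (abs_gridPoint_le z i) 2
        _ = d * ((M : ℝ) + 2) ^ 2 := by simp
        _ ≤ (d * ((M : ℝ) + 2)) ^ 2 := by
          rw [mul_pow]
          refine mul_le_mul_of_nonneg_right ?_ (by positivity)
          have : (1 : ℝ) ≤ d := by exact_mod_cast hd
          nlinarith
    calc s * _ ≤ s * (d * (M + 2)) := mul_le_mul_of_nonneg_left h1 hs0.le
      _ = R / 2 := by rw [hs]; field_simp
      _ < R := by linarith
  · have hle : s / 2 / k ≤ s / 2 := div_le_self (by positivity) hk1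
    rcases z with z | m
    · rcases z' with z' | m'
      · obtain ⟨i, hi⟩ := exists_gridPoint_sub (M := M) hd hk (fun h' => h (congrArg _ h') : z ≠ z')
        refine le_trans ?_ (hdist _ _ i)
        calc s / 2 / k = s * (1 / 2 / k) := by ring
          _ ≤ _ := mul_le_mul_of_nonneg_left hi hs0.le
      · rw [norm_sub_rev]
        exact hle.trans (hright _ _ h.symm rfl)
    · exact hle.trans (hright _ _ h rfl)

end Geometry

/-! ### The perturbed distributions and their class proportions -/

section Model

variable {J : Type*} {M : ℕ}

/-- The class which competes with `m₀` at an atom. -/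
def atomTarget (m₀ m₁ : Fin M) : (J × Bool) ⊕ Fin M → Fin M
  | .inl _ => m₁
  | .inr m => if m = m₀ then m₁ else m

/-- The posterior probability at an atom of the class which competes with `m₀`. -/
def atomAmount (m₀ : Fin M) (δ a b : ℝ) (σ : J → Bool) : (J × Bool) ⊕ Fin M → ℝ
  | .inl (j, s) => if σ j = s then b * (1 + a) else b * (1 - a)
  | .inr m => if m = m₀ then 0 else δ

/-- The mass of an atom. The masses at the atoms of `m₀` and `m₁` compensate for the grid,
whose total mass is `W`. -/
def atomWeight (m₀ m₁ : Fin M) (ε δ b w W : ℝ) : (J × Bool) ⊕ Fin M → ℝ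
  | .inl _ => w
  | .inr m => ε + (if m = m₀ then 1 - M * ε - W + b * W / δ else 0) -
      if m = m₁ then b * W / δ else 0

/-- The proportions of the classes. -/
def proportion (m₀ : Fin M) (ε δ : ℝ) (m : Fin M) : ℝ :=
  if m = m₀ then 1 - (M - 1) * (ε * δ) else ε * δ

theorem atomTarget_ne {m₀ m₁ : Fin M} (hm : m₁ ≠ m₀) (i : (J × Bool) ⊕ Fin M) :
    atomTarget m₀ m₁ i ≠ m₀ := by
  rcases i with _ | m
  · exact hm
  · simp only [atomTarget]
    split_ifs with h
    · exact hm
    · exact h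

theorem sum_atomWeight [Fintype J] {ε δ b W : ℝ} (m₀ m₁ : Fin M) {w : ℝ} (hw : 2 * Fintype.card J * w = W) :
    ∑ i : (J × Bool) ⊕ Fin M, atomWeight m₀ m₁ ε δ b w W i = 1 := by
  rw [Fintype.sum_sum_type]
  simp only [atomWeight, Finset.sum_const, Finset.card_univ, Fintype.card_prod, Fintype.card_bool,
    nsmul_eq_mul, Finset.sum_add_distrib, Finset.sum_sub_distrib, Finset.sum_ite_eq',
    Finset.mem_univ, if_true, Fintype.card_fin]
  push_cast
  rw [← hw]
  ring

/-- The amplitudes ±a cancel within each cell, which is why every cell carries two atoms: the class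
masses of the grid do not depend on σ. -/
theorem sum_grid [Fintype J] {δ a b W : ℝ} (m₀ m₁ : Fin M) {w : ℝ} (hw : 2 * Fintype.card J * w = W) (σ : J → Bool)
    (m : Fin M) :
    ∑ z : J × Bool, w * twoClass m₀ m₁ (atomAmount m₀ δ a b σ (.inl z)) m =
      W * twoClass m₀ m₁ b m := by
  have h1 : ∀ j : J, ∑ s : Bool, w * twoClass m₀ m₁ (atomAmount m₀ δ a b σ (.inl (j, s))) m =
      2 * w * twoClass m₀ m₁ b m := by
    intro j
    rw [Fintype.sum_bool]
    simp only [atomAmount, twoClass]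
    cases σ j <;> simp only [if_true, Bool.false_eq_true, Bool.true_eq_false, if_false] <;>
      split_ifs <;> ring
  rw [Fintype.sum_prod_type]
  simp_rw [h1]
  rw [Finset.sum_const, Finset.card_univ, nsmul_eq_mul, ← hw]
  ring

/-- The constraints on the parameters of the construction. -/
structure Admissible (M : ℕ) (β ε δ a b W : ℝ) : Prop where
  two_le : 2 ≤ M
  ε_pos : 0 < ε
  ε_le : M * ε ≤ 1 / 4
  ε_le_pow : M * ε ≤ (1 / 2 : ℝ) ^ β
  δ_pos : 0 < δ
  δ_le : M * δ ≤ 1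
  a_pos : 0 < a
  a_le : a ≤ 1
  b_eq : b * (1 - (M - 1) * (ε * δ) + ε * δ) = ε * δ
  W_nonneg : 0 ≤ W
  W_le : W ≤ ε
  W_le_pow : W ≤ (a / 3) ^ β

namespace Admissible

variable {β ε δ a b W : ℝ} (h : Admissible M β ε δ a b W)
include h

theorem two_le_cast : (2 : ℝ) ≤ M := by exact_mod_cast h.two_le

theorem ε_le_eighth : ε ≤ 1 / 8 := by
  nlinarith [h.two_le_cast, h.ε_pos, h.ε_le]

theorem δ_le_half : δ ≤ 1 / 2 := by
  nlinarith [h.two_le_cast, h.δ_pos, h.δ_le]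

theorem mass_pos : 0 < ε * δ := mul_pos h.ε_pos h.δ_pos

theorem mass_le : (M - 1) * (ε * δ) ≤ δ / 4 := by
  nlinarith [h.δ_pos, h.ε_pos, h.ε_le, mul_le_mul_of_nonneg_right h.ε_le h.δ_pos.le, h.mass_pos]

theorem mass_le_self : ε * δ ≤ (M - 1) * (ε * δ) := by
  nlinarith [h.two_le_cast, h.mass_pos]

theorem b_pos : 0 < b := by
  have h1 := h.b_eq
  have h2 := h.mass_pos
  have h3 := h.mass_le
  have h4 := h.δ_le_half
  by_contra! hb
  nlinarith

theorem b_le : b ≤ δ / 4 := by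
  have h1 := h.b_eq
  have h2 := h.mass_pos
  have h3 := h.mass_le
  have h4 := h.δ_le_half
  have h5 := h.b_pos
  have h6 : b * (1 / 2) ≤ ε * δ := by
    rw [← h1]
    exact mul_le_mul_of_nonneg_left (by linarith) h5.le
  have h7 := mul_le_mul_of_nonneg_right h.ε_le_eighth h.δ_pos.le
  linarith

theorem transfer_nonneg : 0 ≤ b * W / δ :=
  div_nonneg (mul_nonneg h.b_pos.le h.W_nonneg) h.δ_pos.le

theorem transfer_le : b * W / δ ≤ W / 4 := by
  rw [div_le_iff₀ h.δ_pos]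
  nlinarith [mul_le_mul_of_nonneg_right h.b_le h.W_nonneg]

theorem proportion_pos (m₀ m : Fin M) : 0 < proportion m₀ ε δ m := by
  unfold proportion
  split_ifs
  · linarith [h.mass_le, h.δ_le_half]
  · exact h.mass_pos

theorem atomAmount_nonneg (m₀ : Fin M) (σ : J → Bool) (i : (J × Bool) ⊕ Fin M) :
    0 ≤ atomAmount m₀ δ a b σ i := by
  have := h.a_le
  have := h.a_pos
  have := h.b_pos
  have := h.δ_pos
  rcases i with ⟨j, s⟩ | m
  · simp only [atomAmount]
    split_ifs <;> nlinarith
  · simp only [atomAmount]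
    split_ifs <;> linarith

theorem atomAmount_le (m₀ : Fin M) (σ : J → Bool) (i : (J × Bool) ⊕ Fin M) :
    atomAmount m₀ δ a b σ i ≤ δ := by
  have := h.a_le
  have := h.a_pos
  have := h.b_pos
  have := h.b_le
  have := h.δ_pos
  rcases i with ⟨j, s⟩ | m
  · simp only [atomAmount]
    split_ifs <;> nlinarith
  · simp only [atomAmount]
    split_ifs <;> linarith

theorem atomAmount_le_one (m₀ : Fin M) (σ : J → Bool) (i : (J × Bool) ⊕ Fin M) :
    atomAmount m₀ δ a b σ i ≤ 1 := by
  linarith [h.atomAmount_le m₀ σ i, h.δ_le_half]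

theorem atomWeight_nonneg (m₀ m₁ : Fin M) {w : ℝ} (hw : 0 ≤ w) (i : (J × Bool) ⊕ Fin M) :
    0 ≤ atomWeight m₀ m₁ ε δ b w W i := by
  have := h.transfer_nonneg
  have := h.transfer_le
  have := h.W_le
  have := h.W_nonneg
  have := h.ε_le
  have := h.ε_le_eighth
  have := h.ε_pos
  rcases i with _ | m
  · exact hw
  · simp only [atomWeight]
    split_ifs <;> linarith

variable [Fintype J]

/-- Class m₁ receives b W from the grid and δ(ε - b W/δ) from its own atom. Each other class except
m₀ receives εδ from its own atom only, and m₀ follows by complement. -/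
theorem sum_atomWeight_mul_twoClass {m₀ m₁ : Fin M} (hm : m₁ ≠ m₀) {w : ℝ}
    (hw : 2 * Fintype.card J * w = W) (σ : J → Bool) (m : Fin M) :
    ∑ i : (J × Bool) ⊕ Fin M, atomWeight m₀ m₁ ε δ b w W i *
      twoClass m₀ (atomTarget m₀ m₁ i) (atomAmount m₀ δ a b σ i) m = proportion m₀ ε δ m := by
  have key : ∀ m, m ≠ m₀ → ∑ i : (J × Bool) ⊕ Fin M, atomWeight m₀ m₁ ε δ b w W i *
      twoClass m₀ (atomTarget m₀ m₁ i) (atomAmount m₀ δ a b σ i) m = ε * δ := by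
    intro m hmm
    rw [Fintype.sum_sum_type, show ∑ z : J × Bool, atomWeight m₀ m₁ ε δ b w W (.inl z) *
      twoClass m₀ (atomTarget m₀ m₁ (.inl z)) (atomAmount m₀ δ a b σ (.inl z)) m =
        W * twoClass m₀ m₁ b m from sum_grid m₀ m₁ hw σ m, Finset.sum_eq_single m]
    · have hδ := h.δ_pos.ne'
      by_cases h1 : m = m₁
      · subst h1
        simp [twoClass, atomTarget, atomAmount, atomWeight, hmm]
        field_simp
        ring
      · simp [twoClass, atomTarget, atomAmount, atomWeight, hmm, h1]
    · intro m' _ hm'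
      by_cases h1 : m' = m₀
      · simp [twoClass, atomAmount, h1, hmm]
      · simp [twoClass, atomTarget, h1, hmm, hm'.symm]
    · simp
  by_cases hmm : m = m₀
  · subst hmm
    have htot : ∑ m', ∑ i : (J × Bool) ⊕ Fin M, atomWeight m m₁ ε δ b w W i *
        twoClass m (atomTarget m m₁ i) (atomAmount m δ a b σ i) m' = 1 := by
      rw [Finset.sum_comm, ← sum_atomWeight (J := J) (ε := ε) (δ := δ) (b := b) m m₁ hw]
      refine Finset.sum_congr rfl fun i _ => ?_
      rw [← Finset.mul_sum, sum_twoClass (atomTarget_ne hm i), mul_one]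
    rw [← Finset.add_sum_erase _ _ (Finset.mem_univ m),
      Finset.sum_congr rfl fun j hj => key j (Finset.ne_of_mem_erase hj)] at htot
    rw [Finset.sum_const, Finset.card_erase_of_mem (Finset.mem_univ m), Finset.card_univ,
      Fintype.card_fin, nsmul_eq_mul, Nat.cast_sub (by linarith [h.two_le])] at htot
    simp only [proportion, if_true]
    push_cast at htot
    linarith
  · rw [key m hmm]
    simp [proportion, hmm]

end Admissible

end Model

/-! ### Score gaps, margin and affinity of the perturbed distributions -/

section Model

variable {J : Type*} {M : ℕ}

/-- The signed amplitude of the perturbation at an atom of the grid. -/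
theorem atomAmount_inl {δ a b : ℝ} (m₀ : Fin M) (σ : J → Bool) (j : J) (s : Bool) :
    atomAmount m₀ δ a b σ (.inl (j, s)) = b * (1 + if σ j = s then a else -a) := by
  simp only [atomAmount]
  split_ifs <;> ring

namespace Admissible

variable {β ε δ a b W : ℝ} (h : Admissible M β ε δ a b W)
include h

/-- The two competing scores at an atom of the grid. -/
theorem grid_scores {m₀ m₁ : Fin M} (hm : m₁ ≠ m₀) (e : ℝ) :
    ∃ B ρ : ℝ, 1 ≤ B ∧ 0 ≤ ρ ∧ ρ ≤ 1 ∧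
      (1 - b * (1 + e)) / proportion m₀ ε δ m₀ = B * (1 - ρ * e) ∧
      b * (1 + e) / proportion m₀ ε δ m₁ = B * (1 + e) := by
  have h0 : 0 < 1 - (M - 1) * (ε * δ) := by
    simpa [proportion] using h.proportion_pos m₀ m₀
  have h1 := h.mass_pos
  have hb := h.b_eq
  simp only [proportion, if_true, hm, if_false]
  set p₁ := ε * δ with hp₁
  set p₀ := 1 - (M - 1) * p₁ with hp₀
  have hs : 0 < p₀ + p₁ := by linarith
  have hle : p₁ ≤ p₀ := by
    have := h.mass_le
    have := h.δ_le_half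
    have := h.ε_le_eighth
    nlinarith [h.δ_pos]
  -- The equation for b means b = p₁/(p₀+p₁), where both scores equal B = 1/(p₀+p₁). Here B ≥ 1
  -- because p₀+p₁ = 1 - (M-2)p₁ ≤ 1.
  refine ⟨1 / (p₀ + p₁), p₁ / p₀, ?_, by positivity, (div_le_one h0).2 hle, ?_, ?_⟩
  · rw [le_div_iff₀ hs]
    have := h.mass_le_self
    linarith
  · have hb' : b = p₁ / (p₀ + p₁) := by rw [eq_div_iff hs.ne', hb]
    rw [hb']
    field_simp
    ring
  · have hb' : b = p₁ / (p₀ + p₁) := by rw [eq_div_iff hs.ne', hb]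
    rw [hb']
    field_simp

/-- After cancelling B the ratio is (1+ρ)a / (2+(1-ρ)e), whose denominator is at most 3. -/
theorem le_gap_grid {m₀ m₁ : Fin M} (hm : m₁ ≠ m₀) {e : ℝ} (he : |e| = a) :
    a / 3 ≤ |(1 - b * (1 + e)) / proportion m₀ ε δ m₀ - b * (1 + e) / proportion m₀ ε δ m₁| /
      ((1 - b * (1 + e)) / proportion m₀ ε δ m₀ + b * (1 + e) / proportion m₀ ε δ m₁) := by
  obtain ⟨B, ρ, hB, hρ0, hρ1, h1, h2⟩ := h.grid_scores hm e
  rw [h1, h2]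
  have ha := h.a_pos
  have ha1 := h.a_le
  have he1 : e ≤ 1 := ((le_abs_self e).trans he.le).trans ha1
  have he2 : -1 ≤ e := by linarith [(neg_abs_le e)]
  rw [show B * (1 - ρ * e) - B * (1 + e) = -(B * (1 + ρ) * e) by ring, abs_neg, abs_mul, he,
    abs_of_nonneg (by nlinarith), show B * (1 - ρ * e) + B * (1 + e) = B * (2 + (1 - ρ) * e) by ring]
  have h3 : -1 ≤ (1 - ρ) * e := by nlinarith
  have h4 : (1 - ρ) * e ≤ 1 := by nlinarith
  rw [div_le_div_iff₀ (by norm_num) (mul_pos (by linarith) (by linarith))]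
  have h5 : a * B * (2 + (1 - ρ) * e) ≤ a * B * 3 :=
    mul_le_mul_of_nonneg_left (by linarith) (by positivity)
  have h6 : 0 ≤ a * B * ρ := by positivity
  linarith

theorem le_abs_sub_grid {m₀ m₁ : Fin M} (hm : m₁ ≠ m₀) {e : ℝ} (he : |e| = a) :
    a ≤ |(1 - b * (1 + e)) / proportion m₀ ε δ m₀ - b * (1 + e) / proportion m₀ ε δ m₁| := by
  obtain ⟨B, ρ, hB, hρ0, hρ1, h1, h2⟩ := h.grid_scores hm e
  rw [h1, h2]
  have ha := h.a_pos
  rw [show B * (1 - ρ * e) - B * (1 + e) = -(B * (1 + ρ) * e) by ring, abs_neg, abs_mul, he,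
    abs_of_nonneg (by nlinarith)]
  refine le_mul_of_one_le_left ha.le ?_
  nlinarith

theorem grid_score_le_iff {m₀ m₁ : Fin M} (hm : m₁ ≠ m₀) (c : Prop) [Decidable c] :
    b * (1 + if c then a else -a) / proportion m₀ ε δ m₁ ≤
      (1 - b * (1 + if c then a else -a)) / proportion m₀ ε δ m₀ ↔ ¬c := by
  obtain ⟨B, ρ, hB, hρ0, hρ1, h1, h2⟩ := h.grid_scores hm (if c then a else -a)
  rw [h1, h2, mul_le_mul_iff_right₀ (by linarith)]
  have ha := h.a_pos
  split_ifs with hc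
  · simp only [hc, not_true_eq_false, iff_false, not_le]
    nlinarith
  · simp only [hc, not_false_eq_true, iff_true]
    nlinarith

/-- The score of m is 1/ε ≥ 8 while that of m₀ is at most 1, so the ratio is at least 7/9. -/
theorem half_lt_gap_class {m₀ m : Fin M} (hm : m ≠ m₀) :
    1 / 2 < |(1 - δ) / proportion m₀ ε δ m₀ - δ / proportion m₀ ε δ m| /
      ((1 - δ) / proportion m₀ ε δ m₀ + δ / proportion m₀ ε δ m) := by
  have h0 := h.proportion_pos m₀ m₀
  have hδ := h.δ_pos
  have hε := h.ε_pos
  have h1 : (1 - δ) / proportion m₀ ε δ m₀ ≤ 1 := by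
    rw [div_le_one h0]
    simp only [proportion, if_true]
    linarith [h.mass_le]
  have h2 : 0 ≤ (1 - δ) / proportion m₀ ε δ m₀ := div_nonneg (by linarith [h.δ_le_half]) h0.le
  have h3 : 8 ≤ δ / proportion m₀ ε δ m := by
    simp only [proportion, hm, if_false]
    rw [le_div_iff₀ h.mass_pos]
    nlinarith [mul_le_mul_of_nonneg_right h.ε_le_eighth hδ.le]
  set A := (1 - δ) / proportion m₀ ε δ m₀
  set C := δ / proportion m₀ ε δ m
  rw [abs_of_neg (by linarith), lt_div_iff₀ (by linarith)]
  linarith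

variable [Fintype J]

/-- The margin condition for the atomic distribution, in terms of the gaps at the atoms. -/
theorem sum_margin_le {m₀ m₁ : Fin M} (hm : m₁ ≠ m₀) (hβ : 0 < β) {cβ : ℝ} (hcβ : 1 ≤ cβ) {w : ℝ}
    (hw0 : 0 ≤ w) (hw : 2 * Fintype.card J * w = W) (G : (J × Bool) ⊕ Fin M → ℝ)
    (hG₀ : G (.inr m₀) = 1) (hG : ∀ m, m ≠ m₀ → 1 / 2 < G (.inr m))
    (hGgrid : ∀ z, a / 3 ≤ G (.inl z)) {t : ℝ} (ht : 0 < t) :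
    ∑ i, (if G i ≤ t then atomWeight m₀ m₁ ε δ b w W i else 0) ≤ cβ * t ^ β := by
  classical
  have hwn := h.atomWeight_nonneg (J := J) m₀ m₁ hw0
  have hsum := sum_atomWeight (J := J) (ε := ε) (δ := δ) (b := b) m₀ m₁ hw
  have htβ : 0 < t ^ β := Real.rpow_pos_of_pos ht β
  suffices H : ∑ i, (if G i ≤ t then atomWeight m₀ m₁ ε δ b w W i else 0) ≤ t ^ β by
    nlinarith
  -- As t decreases below 1, 1/2 and a/3, first the atom of m₀, then the other class atoms, then the
  -- grid drop out. The remaining mass is at most 1, M ε, W and 0 on the four ranges.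
  rcases le_or_gt 1 t with h1 | h1
  · calc ∑ i, (if G i ≤ t then atomWeight m₀ m₁ ε δ b w W i else 0)
        ≤ ∑ i : (J × Bool) ⊕ Fin M, atomWeight m₀ m₁ ε δ b w W i :=
          Finset.sum_le_sum fun i _ => by split_ifs <;> simp [hwn i]
      _ = 1 := hsum
      _ ≤ t ^ β := Real.one_le_rpow h1 hβ.le
  rcases le_or_gt (1 / 2) t with h2 | h2
  · have hle : ∑ i, (if G i ≤ t then atomWeight m₀ m₁ ε δ b w W i else 0) ≤
        ∑ i : (J × Bool) ⊕ Fin M, (atomWeight m₀ m₁ ε δ b w W i -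
          if i = Sum.inr m₀ then atomWeight m₀ m₁ ε δ b w W (.inr m₀ : (J × Bool) ⊕ Fin M) else 0) := by
      refine Finset.sum_le_sum fun i _ => ?_
      by_cases hi : i = Sum.inr m₀
      · subst hi
        rw [if_neg (by rw [hG₀]; exact not_le.2 h1)]
        simp
      · rw [if_neg hi]
        split_ifs <;> simp [hwn i]
    rw [Finset.sum_sub_distrib, hsum, Finset.sum_ite_eq' Finset.univ (Sum.inr m₀)] at hle
    simp only [Finset.mem_univ, if_true, atomWeight, hm.symm, if_false] at hle
    have := h.transfer_le
    have := h.transfer_nonneg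
    calc _ ≤ _ := hle
      _ ≤ M * ε := by linarith [h.ε_pos, h.W_nonneg, h.W_le]
      _ ≤ (1 / 2 : ℝ) ^ β := h.ε_le_pow
      _ ≤ t ^ β := Real.rpow_le_rpow (by norm_num) h2 hβ.le
  · rw [Fintype.sum_sum_type]
    have hr : ∑ m : Fin M, (if G (.inr m) ≤ t then atomWeight m₀ m₁ ε δ b w W
        (.inr m : (J × Bool) ⊕ Fin M) else 0) = 0 := by
      refine Finset.sum_eq_zero fun m _ => if_neg ?_
      by_cases hmm : m = m₀
      · rw [hmm, hG₀]; linarith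
      · have := hG m hmm; linarith
    rw [hr, add_zero]
    rcases le_or_gt (a / 3) t with h3 | h3
    · calc ∑ z : J × Bool, (if G (.inl z) ≤ t then atomWeight m₀ m₁ ε δ b w W (.inl z) else 0)
          ≤ ∑ _z : J × Bool, w :=
            Finset.sum_le_sum fun z _ => by split_ifs <;> simp [atomWeight, hw0]
        _ = W := by
          rw [Finset.sum_const, Finset.card_univ, Fintype.card_prod, Fintype.card_bool,
            nsmul_eq_mul, ← hw]
          push_cast
          ring
        _ ≤ (a / 3) ^ β := h.W_le_pow
        _ ≤ t ^ β := Real.rpow_le_rpow (by linarith [h.a_pos]) h3 hβ.le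
    · rw [Finset.sum_eq_zero fun z _ => if_neg (by linarith [hGgrid z])]
      exact htβ.le

/-- The Hellinger affinity of two class distributions at an atom of the grid. -/
theorem le_affinity_grid {m₀ m₁ : Fin M} (hm : m₁ ≠ m₀) {e : ℝ} (he : |e| = a) :
    1 - a ^ 2 / 2 ≤ ∑ m, √(twoClass m₀ m₁ (b * (1 + e)) m * twoClass m₀ m₁ (b * (1 - e)) m) := by
  have hterm : ∀ m, √(twoClass m₀ m₁ (b * (1 + e)) m * twoClass m₀ m₁ (b * (1 - e)) m) =
      (if m = m₀ then √((1 - b * (1 + e)) * (1 - b * (1 - e))) else 0) +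
        if m = m₁ then √(b * (1 + e) * (b * (1 - e))) else 0 := by
    intro m
    by_cases h0 : m = m₀
    · subst h0
      simp [twoClass, hm.symm]
    · by_cases h1 : m = m₁ <;> simp [twoClass, h0, h1, hm]
  simp_rw [hterm]
  rw [Finset.sum_add_distrib, Finset.sum_ite_eq', Finset.sum_ite_eq', if_pos (Finset.mem_univ _),
    if_pos (Finset.mem_univ _)]
  have hb := h.b_pos
  have hb1 : b ≤ 1 / 8 := by linarith [h.b_le, h.δ_le_half]
  have ha := h.a_pos
  have hee : e ^ 2 = a ^ 2 := by rw [← sq_abs, he]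
  have ha2 : a ^ 2 ≤ 1 := by nlinarith [h.a_le]
  have ha0 : 0 < a ^ 2 := by positivity
  -- The two square roots are bounded below by b(1 - a²) and 1 - b - b a². The total loss 2 b a² is
  -- at most a²/2 since b ≤ 1/8.
  have h1 : b * (1 - a ^ 2) ≤ √(b * (1 + e) * (b * (1 - e))) := by
    apply Real.le_sqrt_of_sq_le
    rw [show b * (1 + e) * (b * (1 - e)) = b ^ 2 * (1 - e ^ 2) by ring, hee, mul_pow]
    refine mul_le_mul_of_nonneg_left ?_ (sq_nonneg b)
    nlinarith
  have h2 : 1 - b - b * a ^ 2 ≤ √((1 - b * (1 + e)) * (1 - b * (1 - e))) := by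
    apply Real.le_sqrt_of_sq_le
    rw [show (1 - b * (1 + e)) * (1 - b * (1 - e)) = (1 - b) ^ 2 - b ^ 2 * e ^ 2 by ring, hee]
    have h3 : b * (a ^ 2 + 1) ≤ 2 * (1 - b) := by nlinarith
    have h4 := mul_le_mul_of_nonneg_left h3 (by positivity : 0 ≤ b * a ^ 2)
    nlinarith
  nlinarith

/-- The Hellinger affinity of the distributions of one observation under two sign patterns
which differ in one cell. -/
theorem le_affinity [DecidableEq J] {m₀ m₁ : Fin M} (hm : m₁ ≠ m₀) {w : ℝ} (hw0 : 0 ≤ w)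
    (hw : 2 * Fintype.card J * w = W) (σ : J → Bool) (j : J) :
    1 - w * a ^ 2 ≤ ∑ z : ((J × Bool) ⊕ Fin M) × Fin M,
      √((atomWeight m₀ m₁ ε δ b w W z.1 *
          twoClass m₀ (atomTarget m₀ m₁ z.1) (atomAmount m₀ δ a b σ z.1) z.2) *
        (atomWeight m₀ m₁ ε δ b w W z.1 * twoClass m₀ (atomTarget m₀ m₁ z.1)
          (atomAmount m₀ δ a b (Function.update σ j (!σ j)) z.1) z.2)) := by
  classical
  have hwn := h.atomWeight_nonneg (J := J) m₀ m₁ hw0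
  have hsum := sum_atomWeight (J := J) (ε := ε) (δ := δ) (b := b) m₀ m₁ hw
  have hsame : ∀ i : (J × Bool) ⊕ Fin M, atomAmount m₀ δ a b (Function.update σ j (!σ j)) i =
      atomAmount m₀ δ a b σ i → ∑ m, √((atomWeight m₀ m₁ ε δ b w W i *
          twoClass m₀ (atomTarget m₀ m₁ i) (atomAmount m₀ δ a b σ i) m) *
        (atomWeight m₀ m₁ ε δ b w W i * twoClass m₀ (atomTarget m₀ m₁ i)
          (atomAmount m₀ δ a b (Function.update σ j (!σ j)) i) m)) =
      atomWeight m₀ m₁ ε δ b w W i := by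
    intro i hi
    rw [hi]
    have hnn := twoClass_nonneg m₀ (atomTarget m₀ m₁ i) (h.atomAmount_nonneg m₀ σ i)
      (h.atomAmount_le_one m₀ σ i)
    simp_rw [Real.sqrt_mul_self (mul_nonneg (hwn i) (hnn _))]
    rw [← Finset.mul_sum, sum_twoClass (atomTarget_ne hm i), mul_one]
  rw [Fintype.sum_prod_type]
  -- Only the two atoms of cell j feel the flip, and each loses at most w a²/2.
  have hbound : ∀ i : (J × Bool) ⊕ Fin M, atomWeight m₀ m₁ ε δ b w W i -
      (if i = Sum.inl (j, true) then w * (a ^ 2 / 2) else 0) -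
      (if i = Sum.inl (j, false) then w * (a ^ 2 / 2) else 0) ≤
      ∑ m, √((atomWeight m₀ m₁ ε δ b w W i *
          twoClass m₀ (atomTarget m₀ m₁ i) (atomAmount m₀ δ a b σ i) m) *
        (atomWeight m₀ m₁ ε δ b w W i * twoClass m₀ (atomTarget m₀ m₁ i)
          (atomAmount m₀ δ a b (Function.update σ j (!σ j)) i) m)) := by
    intro i
    rcases i with ⟨j', s⟩ | m
    · by_cases hj : j' = j
      · subst hj
        have hLHS : atomWeight m₀ m₁ ε δ b w W (Sum.inl (j', s) : (J × Bool) ⊕ Fin M) -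
            (if (Sum.inl (j', s) : (J × Bool) ⊕ Fin M) = Sum.inl (j', true)
              then w * (a ^ 2 / 2) else 0) -
            (if (Sum.inl (j', s) : (J × Bool) ⊕ Fin M) = Sum.inl (j', false)
              then w * (a ^ 2 / 2) else 0) = w * (1 - a ^ 2 / 2) := by
          cases s <;> simp [atomWeight] <;> ring
        rw [hLHS]
        have he : |(if σ j' = s then a else -a)| = a := by
          split_ifs <;> simp [abs_of_pos h.a_pos]
        have h1 := atomAmount_inl (δ := δ) (a := a) (b := b) m₀ σ j' s
        have h2 : atomAmount m₀ δ a b (Function.update σ j' (!σ j')) (.inl (j', s)) =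
            b * (1 - if σ j' = s then a else -a) := by
          rw [atomAmount_inl]
          cases s <;> cases σ j' <;> simp [sub_eq_add_neg]
        rw [h1, h2]
        have h3 := h.le_affinity_grid hm he
        simp only [atomWeight, atomTarget]
        have h4 : ∀ m, √(w * twoClass m₀ m₁ (b * (1 + if σ j' = s then a else -a)) m *
            (w * twoClass m₀ m₁ (b * (1 - if σ j' = s then a else -a)) m)) =
            w * √(twoClass m₀ m₁ (b * (1 + if σ j' = s then a else -a)) m *
              twoClass m₀ m₁ (b * (1 - if σ j' = s then a else -a)) m) := by
          intro m
          rw [mul_mul_mul_comm, Real.sqrt_mul (mul_self_nonneg w), Real.sqrt_mul_self hw0]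
        simp_rw [h4]
        rw [← Finset.mul_sum]
        exact mul_le_mul_of_nonneg_left h3 hw0
      · rw [hsame _ (by simp [atomAmount, hj])]
        simp [hj]
    · rw [hsame _ (by simp [atomAmount])]
      simp
  refine le_trans (le_of_eq ?_) (Finset.sum_le_sum fun i _ => hbound i)
  rw [Finset.sum_sub_distrib, Finset.sum_sub_distrib, hsum, Finset.sum_ite_eq',
    Finset.sum_ite_eq', if_pos (Finset.mem_univ _), if_pos (Finset.mem_univ _)]
  ring

end Admissible

end Model

/-! ### Averaging over sign patterns -/

section Assouad

/-- Assouad's lemma for the errors of a family of tests indexed by the sign patterns. -/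
theorem sum_error_ge {J : Type*} [Fintype J] [DecidableEq J] (err : (J → Bool) → J → ℝ) {c : ℝ}
    (h : ∀ σ j, c ≤ err σ j + err (Function.update σ j (!σ j)) j) :
    ∑ _σ : J → Bool, c / 2 * Fintype.card J ≤ ∑ σ, ∑ j, err σ j := by
  have key : ∀ j, ∑ _σ : J → Bool, c / 2 ≤ ∑ σ, err σ j := by
    intro j
    -- Flipping the sign of cell j permutes the patterns, so both terms of the hypothesis have the
    -- same sum over σ.
    have hinv : Function.Involutive fun σ : J → Bool => Function.update σ j (!σ j) := by
      intro σ
      simp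
    have h1 : ∑ σ, err (Function.update σ j (!σ j)) j = ∑ σ, err σ j :=
      Equiv.sum_comp hinv.toPerm fun σ => err σ j
    have h2 : ∑ _σ : J → Bool, c ≤ ∑ σ, (err σ j + err (Function.update σ j (!σ j)) j) :=
      Finset.sum_le_sum fun σ _ => h σ j
    rw [Finset.sum_add_distrib, h1] at h2
    rw [← Finset.sum_div]
    linarith
  rw [Finset.sum_comm]
  calc ∑ _σ : J → Bool, c / 2 * Fintype.card J = ∑ _j : J, ∑ _σ : J → Bool, c / 2 := by
        simp only [Finset.sum_const, Finset.card_univ, nsmul_eq_mul]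
        ring
    _ ≤ _ := Finset.sum_le_sum fun j _ => key j

end Assouad

/-! ### Lower bound on the regret for some sign pattern -/

section Model

variable {J : Type*} [Fintype J] {M d : ℕ} {β ε δ a b w W : ℝ} {m₀ m₁ : Fin M}
  {x : (J × Bool) ⊕ Fin M → Feature d} {κ : (J → Bool) → Kernel (Feature d) (Fin M)}
  [∀ σ, IsMarkovKernel (κ σ)]

theorem Admissible.classProb_eq (h : Admissible M β ε δ a b W) (hm : m₁ ≠ m₀) (hw0 : 0 ≤ w)
    (hw : 2 * Fintype.card J * w = W)
    (hκ : ∀ σ i m, posterior (κ σ) (x i) m =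
      twoClass m₀ (atomTarget m₀ m₁ i) (atomAmount m₀ δ a b σ i) m) (σ : J → Bool) (m : Fin M) :
    classProb ((atomic (atomWeight m₀ m₁ ε δ b w W) x) ⊗ₘ κ σ) m = proportion m₀ ε δ m := by
  rw [classProb_compProd (h.atomWeight_nonneg m₀ m₁ hw0)]
  simp_rw [hκ]
  exact h.sum_atomWeight_mul_twoClass hm hw σ m

theorem Admissible.marginCondition (h : Admissible M β ε δ a b W) (hm : m₁ ≠ m₀) (hβ : 0 < β)
    {cβ : ℝ} (hcβ : 1 ≤ cβ) (hw0 : 0 ≤ w) (hw : 2 * Fintype.card J * w = W)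
    (hκ : ∀ σ i m, posterior (κ σ) (x i) m =
      twoClass m₀ (atomTarget m₀ m₁ i) (atomAmount m₀ δ a b σ i) m) (σ : J → Bool) :
    MarginCondition ((atomic (atomWeight m₀ m₁ ε δ b w W) x) ⊗ₘ κ σ) β cβ (κ σ) := by
  intro t ht
  set P := (atomic (atomWeight m₀ m₁ ε δ b w W) x) ⊗ₘ κ σ with hP
  rw [margin_real (h.atomWeight_nonneg m₀ m₁ hw0) (fun y =>
    |kthLargest (weightedPosterior P (κ σ) y) 1 - kthLargest (weightedPosterior P (κ σ) y) 2|)]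
  have hgap := fun i => gap_weightedPosterior P i (atomTarget_ne hm i) (h.proportion_pos m₀)
    (h.classProb_eq hm hw0 hw hκ σ) (h.atomAmount_nonneg m₀ σ i) (h.atomAmount_le_one m₀ σ i)
    (hκ σ i)
  refine h.sum_margin_le hm hβ hcβ hw0 hw _ ?_ (fun m hmm => ?_) (fun z => ?_) ht
  · rw [hgap]
    have h0 := h.proportion_pos m₀ m₀
    simp only [atomAmount, if_true, sub_zero, zero_div, add_zero]
    rw [abs_of_pos (by positivity), div_self (by positivity)]
  · rw [hgap]
    simp only [atomAmount, atomTarget, hmm, if_false]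
    exact h.half_lt_gap_class hmm
  · obtain ⟨j, s⟩ := z
    rw [hgap, atomAmount_inl]
    refine h.le_gap_grid hm ?_
    split_ifs <;> simp [abs_of_pos h.a_pos]

-- Of each cell only the atom (j, true) is kept, where a wrong label costs at least w a / M; all
-- discarded terms are nonnegative.
open Classical in
theorem Admissible.le_expectedRegret (h : Admissible M β ε δ a b W) (hm : m₁ ≠ m₀) (hw0 : 0 ≤ w)
    (hw : 2 * Fintype.card J * w = W) (hx : Function.Injective x)
    (hκ : ∀ σ i m, posterior (κ σ) (x i) m =
      twoClass m₀ (atomTarget m₀ m₁ i) (atomAmount m₀ δ a b σ i) m) (n : ℕ)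
    (f : (Fin n → Feature d × ℝ) × Feature d → ℝ) (σ : J → Bool) :
    1 / (M : ℝ) * (w * a) * ∑ j, ∑ D : Fin n → ((J × Bool) ⊕ Fin M) × Fin M,
      (∏ i, atomWeight m₀ m₁ ε δ b w W (D i).1 * twoClass m₀ (atomTarget m₀ m₁ (D i).1)
        (atomAmount m₀ δ a b σ (D i).1) (D i).2) *
      (if f (fun i => (x (D i).1, label (D i).2), x (.inl (j, true))) =
        label (if σ j = true then m₁ else m₀) then 0 else 1) ≤
      expectedRegret ((atomic (atomWeight m₀ m₁ ε δ b w W) x) ⊗ₘ κ σ) n f := by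
  have hwn := h.atomWeight_nonneg (J := J) m₀ m₁ hw0
  have : Nonempty ((J × Bool) ⊕ Fin M) := ⟨.inr m₀⟩
  rw [expectedRegret_compProd hwn, Finset.sum_comm, Finset.mul_sum]
  refine Finset.sum_le_sum fun D _ => ?_
  simp_rw [hκ]
  rw [← Finset.mul_sum, mul_left_comm]
  refine mul_le_mul_of_nonneg_left ?_ (Finset.prod_nonneg fun i _ => mul_nonneg (hwn _)
    (twoClass_nonneg _ _ (h.atomAmount_nonneg m₀ σ _) (h.atomAmount_le_one m₀ σ _) _))
  refine le_trans ?_ (le_amRegret_compProd hwn hx (atomTarget_ne hm) (h.proportion_pos m₀)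
    (h.classProb_eq hm hw0 hw hκ σ) (h.atomAmount_nonneg m₀ σ) (h.atomAmount_le_one m₀ σ) (hκ σ) _)
  rw [mul_assoc]
  refine mul_le_mul_of_nonneg_left ?_ (by positivity)
  rw [Fintype.sum_sum_type, Fintype.sum_prod_type, Finset.mul_sum]
  have hnn : ∀ (i : (J × Bool) ⊕ Fin M) (c : Prop) [Decidable c] (A : ℝ),
      0 ≤ atomWeight m₀ m₁ ε δ b w W i * (|A| * if c then 0 else 1) := by
    intro i c _ A
    refine mul_nonneg (hwn i) (mul_nonneg (abs_nonneg _) ?_)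
    split_ifs <;> norm_num
  refine le_trans ?_ (le_add_of_nonneg_right (Finset.sum_nonneg fun m _ => hnn _ _ _))
  refine Finset.sum_le_sum fun j _ => ?_
  rw [Fintype.sum_bool]
  refine le_trans ?_ (le_add_of_nonneg_right (hnn _ _ _))
  rw [atomAmount_inl]
  have he : |(if σ j = true then a else -a)| = a := by
    split_ifs <;> simp [abs_of_pos h.a_pos]
  have h1 := h.le_abs_sub_grid hm he
  have h2 := h.grid_score_le_iff hm (σ j = true)
  have h3 : (if b * (1 + if σ j = true then a else -a) / proportion m₀ ε δ m₁ ≤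
      (1 - b * (1 + if σ j = true then a else -a)) / proportion m₀ ε δ m₀ then m₀ else m₁) =
      if σ j = true then m₁ else m₀ := by
    by_cases hc : σ j = true
    · rw [if_neg (fun h' => h2.1 h' hc), if_pos hc]
    · rw [if_pos (h2.2 hc), if_neg hc]
  rw [show atomTarget m₀ m₁ (.inl (j, true)) = m₁ from rfl,
    show atomWeight m₀ m₁ ε δ b w W (.inl (j, true)) = w from rfl, h3, mul_assoc]
  refine mul_le_mul_of_nonneg_left (mul_le_mul_of_nonneg_right h1 ?_) hw0
  split_ifs <;> norm_num

/-- For some sign pattern, the classifier is wrong at a constant fraction of the grid. -/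
theorem Admissible.exists_le_expectedRegret (h : Admissible M β ε δ a b W) (hm : m₁ ≠ m₀)
    (hw0 : 0 ≤ w) (hw : 2 * Fintype.card J * w = W) (hx : Function.Injective x)
    (hκ : ∀ σ i m, posterior (κ σ) (x i) m =
      twoClass m₀ (atomTarget m₀ m₁ i) (atomAmount m₀ δ a b σ i) m) {n : ℕ}
    (hn : n * (w * a ^ 2) ≤ 1 / 4) (f : (Fin n → Feature d × ℝ) × Feature d → ℝ) :
    ∃ σ, W * a / (16 * M) ≤
      expectedRegret ((atomic (atomWeight m₀ m₁ ε δ b w W) x) ⊗ₘ κ σ) n f := by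
  classical
  have hwn := h.atomWeight_nonneg (J := J) m₀ m₁ hw0
  let g : (J → Bool) → ((J × Bool) ⊕ Fin M) × Fin M → ℝ := fun σ z =>
    atomWeight m₀ m₁ ε δ b w W z.1 *
      twoClass m₀ (atomTarget m₀ m₁ z.1) (atomAmount m₀ δ a b σ z.1) z.2
  have hg0 : ∀ σ z, 0 ≤ g σ z := fun σ z => mul_nonneg (hwn _)
    (twoClass_nonneg _ _ (h.atomAmount_nonneg m₀ σ _) (h.atomAmount_le_one m₀ σ _) _)
  have hg1 : ∀ σ, ∑ z, g σ z = 1 := fun σ => by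
    rw [Fintype.sum_prod_type, ← sum_atomWeight (J := J) (ε := ε) (δ := δ) (b := b) m₀ m₁ hw]
    refine Finset.sum_congr rfl fun i _ => ?_
    simp only [g]
    rw [← Finset.mul_sum, sum_twoClass (atomTarget_ne hm i), mul_one]
  let e : (J → Bool) → J → (Fin n → ((J × Bool) ⊕ Fin M) × Fin M) → ℝ := fun σ j D =>
    if f (fun i => (x (D i).1, label (D i).2), x (.inl (j, true))) =
      label (if σ j = true then m₁ else m₀) then 0 else 1
  have he0 : ∀ σ j D, 0 ≤ e σ j D := fun σ j D => by
    simp only [e]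
    split_ifs <;> norm_num
  let err : (J → Bool) → J → ℝ := fun σ j => ∑ D, (∏ i, g σ (D i)) * e σ j D
  have hreg : ∀ σ, 1 / (M : ℝ) * (w * a) * ∑ j, err σ j ≤
      expectedRegret ((atomic (atomWeight m₀ m₁ ε δ b w W) x) ⊗ₘ κ σ) n f := fun σ =>
    h.le_expectedRegret hm hw0 hw hx hκ n f σ
  -- The patterns σ and its flip at j require different labels at the atom (j, true), so for each
  -- sample the classifier is wrong under at least one of them.
  have hpair : ∀ σ j, 1 / 4 ≤ err σ j + err (Function.update σ j (!σ j)) j := by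
    intro σ j
    have h1 := sq_affinity_pow_le n (g σ) (g (Function.update σ j (!σ j))) (e σ j)
      (e (Function.update σ j (!σ j)) j) (hg0 _) (hg0 _) (hg1 _) (hg1 _) (he0 _ _) (he0 _ _) (by
        intro D
        simp only [e, Function.update_self]
        have hl : label m₁ ≠ label m₀ := fun h' => hm (label_injective h')
        by_cases h2 : f (fun i => (x (D i).1, label (D i).2), x (.inl (j, true))) = label m₁
        · cases σ j <;> simp [h2, hl]
        · cases σ j <;> simp [h2] <;> split_ifs <;> norm_num)
    refine le_trans ?_ h1
    have h2 := h.le_affinity hm hw0 hw σ j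
    have h3 : 0 ≤ w * a ^ 2 := by positivity
    -- This comes from w ≤ W ≤ 1/8 rather than from `hn`, which says nothing when n = 0.
    have hle : w * a ^ 2 ≤ 1 := by
      have hcard : (1 : ℝ) ≤ Fintype.card J := by
        exact_mod_cast Fintype.card_pos_iff.2 ⟨j⟩
      have := h.W_le
      have := h.ε_le_eighth
      have ha2 : a ^ 2 ≤ 1 := by nlinarith [h.a_le, h.a_pos]
      nlinarith
    -- Bernoulli: (1 - w a²)^(2n) ≥ 1 - 2 n w a² ≥ 1/2, and Le Cam's inequality halves this.
    have h4 := one_add_mul_le_pow (a := -(w * a ^ 2)) (by linarith) (2 * n)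
    have h5 := pow_le_pow_left₀ (by linarith) h2 (2 * n)
    push_cast at h4
    rw [← sub_eq_add_neg] at h4
    have h6 : (1 : ℝ) / 2 ≤ 1 + 2 * n * -(w * a ^ 2) := by linarith
    have h7 := h6.trans (h4.trans h5)
    linarith
  have hsum := sum_error_ge err hpair
  obtain ⟨σ, -, hσ⟩ := Finset.exists_le_of_sum_le Finset.univ_nonempty hsum
  -- The expected number of errors is at least |J|/8, each costing w a / M, and w |J| = W/2; hence
  -- the factor 1/16.
  refine ⟨σ, le_trans (le_of_eq ?_) ((mul_le_mul_of_nonneg_left hσ ?_).trans (hreg σ))⟩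
  · rw [← hw]
    have : (M : ℝ) ≠ 0 := by
      have := h.two_le_cast
      positivity
    field_simp
    ring
  · have := h.a_pos
    positivity

end Model

/-! ### Choice of the mesh -/

section Rate

/-- The mesh of the grid. -/
theorem exists_mesh {s τ γ : ℝ} (hs : 0 < s) (hτ : 0 < τ) (hτs : τ ≤ s) (hγ : 0 ≤ γ) {n : ℕ}
    (hn : 1 ≤ n) : ∃ k : ℕ, 1 ≤ k ∧ (n : ℝ) ≤ (k : ℝ) ^ s ∧
      (2 : ℝ) ^ (-γ) * (n : ℝ) ^ (-γ / τ) ≤ (k : ℝ) ^ (-γ) := by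
  have hn1 : (1 : ℝ) ≤ n := by exact_mod_cast hn
  have hn0 : (0 : ℝ) < n := by linarith
  set y : ℝ := (n : ℝ) ^ (1 / s) with hy
  have hy1 : 1 ≤ y := Real.one_le_rpow hn1 (by positivity)
  have hky : y ≤ (⌈y⌉₊ : ℝ) := Nat.le_ceil y
  have hk2 : (⌈y⌉₊ : ℝ) ≤ 2 * y := by linarith [Nat.ceil_lt_add_one (by linarith : 0 ≤ y)]
  have hk0 : (0 : ℝ) < (⌈y⌉₊ : ℝ) := by linarith
  refine ⟨⌈y⌉₊, Nat.one_le_ceil_iff.2 (by linarith), ?_, ?_⟩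
  · calc (n : ℝ) = y ^ s := by
          rw [hy, ← Real.rpow_mul hn0.le, one_div_mul_cancel hs.ne', Real.rpow_one]
      _ ≤ _ := Real.rpow_le_rpow (by linarith) hky hs.le
  · calc (2 : ℝ) ^ (-γ) * (n : ℝ) ^ (-γ / τ) ≤ (2 : ℝ) ^ (-γ) * y ^ (-γ) := by
          refine mul_le_mul_of_nonneg_left ?_ (by positivity)
          rw [hy, ← Real.rpow_mul hn0.le]
          -- The sharper exponent -γ/s is relaxed to -γ/τ, using n ≥ 1 and τ ≤ s.
          refine Real.rpow_le_rpow_of_exponent_le hn1 ?_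
          rw [neg_div, mul_neg, neg_le_neg_iff, one_div_mul_eq_div]
          exact div_le_div_of_nonneg_left hγ hτ hτs
      _ = (2 * y) ^ (-γ) := (Real.mul_rpow (by norm_num) (by linarith)).symm
      _ ≤ _ := Real.rpow_le_rpow_of_nonpos hk0 hk2 (by linarith)

end Rate

/-! ### Hölder condition between atoms -/

section Model

/-- The conditional class probabilities at the atoms are Hölder continuous if the atoms are
sufficiently separated. -/
theorem Admissible.abs_twoClass_sub_le {J : Type*} {M : ℕ} {E : Type*} [NormedAddCommGroup E]
    {α β ε δ b W r c : ℝ} {k : ℕ} (hk : 1 ≤ k) (h : Admissible M β ε δ ((k : ℝ) ^ (-α)) b W)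
    (hα : 0 < α) (hr : 0 < r) (hc : 0 < c) (hδ : δ ≤ c * r ^ α)
    {m₀ m₁ : Fin M} {x : (J × Bool) ⊕ Fin M → E}
    (hx : ∀ z z', z ≠ z' → r / k ≤ ‖x z - x z'‖)
    (hx' : ∀ z z', z ≠ z' → z.isRight → r ≤ ‖x z - x z'‖) (σ : J → Bool)
    (i i' : (J × Bool) ⊕ Fin M) (m : Fin M) (hmm : m ≠ m₀) :
    |twoClass m₀ (atomTarget m₀ m₁ i) (atomAmount m₀ δ ((k : ℝ) ^ (-α)) b σ i) m -
      twoClass m₀ (atomTarget m₀ m₁ i') (atomAmount m₀ δ ((k : ℝ) ^ (-α)) b σ i') m| ≤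
      c * ‖x i - x i'‖ ^ α := by
  have hk0 : (0 : ℝ) < k := by exact_mod_cast hk
  set a := (k : ℝ) ^ (-α) with ha
  by_cases hii : i = i'
  · subst hii
    rw [sub_self, abs_zero]
    positivity
  have hbd : ∀ i, 0 ≤ twoClass m₀ (atomTarget m₀ m₁ i) (atomAmount m₀ δ a b σ i) m ∧
      twoClass m₀ (atomTarget m₀ m₁ i) (atomAmount m₀ δ a b σ i) m ≤ δ := by
    intro i
    have h0 := h.atomAmount_nonneg m₀ σ i
    have h1 := h.atomAmount_le m₀ σ i
    have := h.δ_pos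
    simp only [twoClass, hmm, if_false]
    split_ifs <;> constructor <;> linarith
  have hfar : r ≤ ‖x i - x i'‖ →
      |twoClass m₀ (atomTarget m₀ m₁ i) (atomAmount m₀ δ a b σ i) m -
        twoClass m₀ (atomTarget m₀ m₁ i') (atomAmount m₀ δ a b σ i') m| ≤
        c * ‖x i - x i'‖ ^ α := by
    intro hr'
    have h1 := hbd i
    have h2 := hbd i'
    have h3 := mul_le_mul_of_nonneg_left (Real.rpow_le_rpow hr.le hr' hα.le) hc.le
    rw [abs_le]
    constructor <;> linarith
  rcases i with ⟨j, s⟩ | z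
  · rcases i' with ⟨j', s'⟩ | z'
    · have h1 := mul_le_mul_of_nonneg_left
        (Real.rpow_le_rpow (by positivity) (hx _ _ hii) hα.le) hc.le
      refine le_trans ?_ h1
      rw [Real.div_rpow hr.le hk0.le, div_eq_mul_inv, ← Real.rpow_neg hk0.le, ← ha, ← mul_assoc]
      have h2 := h.a_pos
      refine le_trans ?_ (mul_le_mul_of_nonneg_right hδ h2.le)
      have h3 : 2 * (b * a) ≤ δ * a := by
        nlinarith [h.b_le, h.δ_pos, mul_le_mul_of_nonneg_right h.b_le h2.le,
          mul_pos h.δ_pos h2]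
      have h4 := mul_pos h.b_pos h2
      simp only [twoClass, atomTarget, hmm, if_false]
      by_cases hm₁ : m = m₁
      · simp only [hm₁, if_true, atomAmount]
        rw [abs_le]
        split_ifs <;> constructor <;> linarith
      · simp only [hm₁, if_false, sub_self, abs_zero]
        exact (mul_pos h.δ_pos h2).le
    · refine hfar ?_
      rw [norm_sub_rev]
      exact hx' _ _ (Ne.symm hii) rfl
  · exact hfar (hx' _ _ hii rfl)

end Model

/-! ### Assembling the minimax bound -/

section Main

theorem minimaxRegret_mono {d M : ℕ} {𝒬 𝒬' : Set (Measure (Feature d × Fin M))} (h : 𝒬 ⊆ 𝒬')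
    (n : ℕ) : minimaxRegret 𝒬 n ≤ minimaxRegret 𝒬' n :=
  iInf_mono fun _ => biSup_mono fun _ hP => h hP

theorem le_minimaxRegret {d M : ℕ} {𝒬 : Set (Measure (Feature d × Fin M))} {n : ℕ} {c : ℝ}
    (h : ∀ f : (Fin n → Feature d × ℝ) × Feature d → ℝ, Measurable f →
      ∃ P ∈ 𝒬, c ≤ expectedRegret P n f) : (c : EReal) ≤ minimaxRegret 𝒬 n := by
  refine le_iInf fun f => ?_
  obtain ⟨P, hP, hc⟩ := h f.1 f.2
  exact le_trans (EReal.coe_le_coe_iff.2 hc)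
    (le_iSup₂ (f := fun P (_ : P ∈ 𝒬) => ((expectedRegret P n f.1 : ℝ) : EReal)) P hP)

/-- The minimax lower bound with class proportions which do not depend on the sample size. -/
theorem exists_proportion_minimaxRegret_ge (d M : ℕ) (hM : 2 ≤ M) (hd : 1 ≤ d)
    {𝒳 : Set (Feature d)} (h𝒳' : (interior 𝒳).Nonempty)
    {α β cL cβ : ℝ} (hα : 0 < α) (hα1 : α ≤ 1) (hβ : 0 < β) (hcL : 0 < cL) (hcβ : 1 ≤ cβ) :
    ∃ p : Fin M → ℝ, (∀ m, 0 < p m) ∧ ∃ c : ℝ, 0 < c ∧ ∀ n : ℕ, 1 ≤ n →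
      ((c * (n : ℝ) ^ (-(α * (β + 1) / (2 * α + d))) : ℝ) : EReal) ≤
        minimaxRegret {P ∈ distClass M 𝒳 α β cL cβ | ∀ m, classProb P m = p m} n := by
  have hM2 : (2 : ℝ) ≤ M := by exact_mod_cast hM
  have hM0 : (0 : ℝ) < M := by linarith
  have hd1 : (1 : ℝ) ≤ d := by exact_mod_cast hd
  obtain ⟨r, hr, hgrid⟩ := exists_separated_points M hd h𝒳'
  let m₀ : Fin M := ⟨0, by omega⟩
  let m₁ : Fin M := ⟨1, by omega⟩
  have hm : m₁ ≠ m₀ := by simp [m₀, m₁]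
  -- Offsets the factor M that the remainder class m₀ loses in the Hölder extension.
  set c := cL / M with hc
  have hc0 : 0 < c := by positivity
  have hMc : M * c = cL := by rw [hc]; field_simp
  -- The first bound leaves room for the remainder class; the second makes the jump between distant
  -- atoms Hölder.
  set δ := min (1 / (M : ℝ)) (c * r ^ α) with hδ
  have hδ0 : 0 < δ := by positivity
  have hMδ : M * δ ≤ 1 := by
    calc M * δ ≤ M * (1 / M) := mul_le_mul_of_nonneg_left (min_le_left _ _) hM0.le
      _ = 1 := by field_simp
  set ε := (1 / 2 : ℝ) ^ β / (4 * M) with hε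
  have hε0 : 0 < ε := by positivity
  have hhalf : (1 / 2 : ℝ) ^ β ≤ 1 := Real.rpow_le_one (by norm_num) (by norm_num) hβ.le
  have hhalf0 : 0 < (1 / 2 : ℝ) ^ β := by positivity
  have hMε : M * ε = (1 / 2 : ℝ) ^ β / 4 := by rw [hε]; field_simp
  have hpos : 0 < 1 - (M - 1) * (ε * δ) + ε * δ := by
    have h1 : M * ε * δ ≤ 1 * δ := mul_le_mul_of_nonneg_right (by linarith) hδ0.le
    have h2 : δ ≤ 1 / 2 := by nlinarith
    nlinarith [mul_pos hε0 hδ0]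
  set b := ε * δ / (1 - (M - 1) * (ε * δ) + ε * δ) with hb
  have hadm : ∀ k : ℕ, 1 ≤ k →
      Admissible M β ε δ ((k : ℝ) ^ (-α)) b (ε * ((k : ℝ) ^ (-α) / 3) ^ β) := by
    intro k hk
    have hk1 : (1 : ℝ) ≤ k := by exact_mod_cast hk
    have hk0 : (0 : ℝ) < k := by linarith
    have ha0 : 0 < (k : ℝ) ^ (-α) := Real.rpow_pos_of_pos hk0 _
    have ha1 : (k : ℝ) ^ (-α) ≤ 1 := Real.rpow_le_one_of_one_le_of_nonpos hk1 (by linarith)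
    have hε1 : ε ≤ 1 := by nlinarith
    have h3 : ((k : ℝ) ^ (-α) / 3) ^ β ≤ 1 := Real.rpow_le_one (by positivity) (by linarith) hβ.le
    have h4 : 0 < ((k : ℝ) ^ (-α) / 3) ^ β := by positivity
    exact
      { two_le := hM
        ε_pos := hε0
        ε_le := by linarith
        ε_le_pow := by linarith
        δ_pos := hδ0
        δ_le := hMδ
        a_pos := ha0
        a_le := ha1
        b_eq := div_mul_cancel₀ _ hpos.ne'
        W_nonneg := by positivity
        W_le := by nlinarith
        W_le_pow := by nlinarith }
  -- The exponent for which w a² is a constant multiple of k^(-s): W gives αβ, a² gives 2α, and the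
  -- number of cells gives d.
  set s := α * (2 + β) + d with hs
  set γ := α * (β + 1) with hγ
  -- Neither ε nor δ involves k, so the proportions are fixed before n is introduced.
  refine ⟨proportion m₀ ε δ, (hadm 1 le_rfl).proportion_pos m₀,
    ε * (1 / 3 : ℝ) ^ β / (16 * M) * (2 : ℝ) ^ (-γ), by positivity, fun n hn => ?_⟩
  obtain ⟨k, hk, hnk, hrate⟩ := exists_mesh (s := s) (τ := 2 * α + d) (γ := γ) (by positivity)
    (by positivity) (by rw [hs]; nlinarith [mul_pos hα hβ]) (by positivity) hn
  have hk1 : (1 : ℝ) ≤ k := by exact_mod_cast hk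
  have hk0 : (0 : ℝ) < k := by linarith
  obtain ⟨x, hx𝒳, hxk, hxr⟩ := hgrid k hk
  have hxinj : Function.Injective x := by
    intro z z' hzz
    by_contra hne
    have := hxk z z' hne
    rw [hzz, sub_self, norm_zero] at this
    have : 0 < r / k := by positivity
    linarith
  have h := hadm k hk
  set a := (k : ℝ) ^ (-α) with ha
  set W := ε * (a / 3) ^ β with hW
  have ha0 := h.a_pos
  have haβ : (a / 3) ^ β = (1 / 3 : ℝ) ^ β * (k : ℝ) ^ (-(α * β)) := by
    rw [show a / 3 = 1 / 3 * a by ring, Real.mul_rpow (by norm_num) ha0.le, ha,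
      ← Real.rpow_mul hk0.le, neg_mul]
  have hcard : (Fintype.card (Fin d → Fin k) : ℝ) = (k : ℝ) ^ (d : ℝ) := by
    simp
  let w : ℝ := W / (2 * (k : ℝ) ^ (d : ℝ))
  have hw0 : 0 ≤ w := div_nonneg h.W_nonneg (by positivity)
  have hw : 2 * Fintype.card (Fin d → Fin k) * w = W := by
    rw [hcard]
    exact mul_div_cancel₀ _ (by positivity)
  have hκ : ∀ σ : (Fin d → Fin k) → Bool, ∃ κ : Kernel (Feature d) (Fin M), IsMarkovKernel κ ∧
      (∀ i m, posterior κ (x i) m =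
        twoClass m₀ (atomTarget m₀ m₁ i) (atomAmount m₀ δ a b σ i) m) ∧
      HolderPosterior 𝒳 α cL κ := by
    intro σ
    have : Nonempty (((Fin d → Fin k) × Bool) ⊕ Fin M) := ⟨.inr m₀⟩
    obtain ⟨κ, h1, h2, h3⟩ := exists_kernel_holder hα hα1 hc0.le hδ0.le hMδ m₀ x
      (fun i => twoClass m₀ (atomTarget m₀ m₁ i) (atomAmount m₀ δ a b σ i))
      (fun i => twoClass_nonneg _ _ (h.atomAmount_nonneg m₀ σ i) (h.atomAmount_le_one m₀ σ i))
      (fun i => sum_twoClass (atomTarget_ne hm i) _)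
      (fun i m hmm => by
        simp only [twoClass, hmm, if_false]
        split_ifs
        · exact h.atomAmount_le m₀ σ i
        · exact hδ0.le)
      (fun i j m hmm => h.abs_twoClass_sub_le hk hα hr hc0 (min_le_right _ _) hxk hxr σ i j m hmm)
    exact ⟨κ, h1, h2, hMc ▸ h3 𝒳⟩
  choose κ hκM hκq hκH using hκ
  have hnw : n * (w * a ^ 2) ≤ 1 / 4 := by
    have h1 : (k : ℝ) ^ s * (w * a ^ 2) = ε * (1 / 3 : ℝ) ^ β / 2 := by
      have e1 : (k : ℝ) ^ s = (k : ℝ) ^ (α * β) * ((k : ℝ) ^ (α * 2) * (k : ℝ) ^ (d : ℝ)) := by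
        rw [← Real.rpow_add hk0, ← Real.rpow_add hk0, hs]
        congr 1
        ring
      have e2 : a ^ 2 = ((k : ℝ) ^ (α * 2))⁻¹ := by
        rw [← Real.rpow_neg hk0.le, ha, ← Real.rpow_natCast, ← Real.rpow_mul hk0.le]
        congr 1
        push_cast
        ring
      have p1 : 0 < (k : ℝ) ^ (α * β) := by positivity
      have p2 : 0 < (k : ℝ) ^ (α * 2) := by positivity
      have p3 : 0 < (k : ℝ) ^ (d : ℝ) := by positivity
      simp only [w]
      rw [e1, e2, hW, haβ, Real.rpow_neg hk0.le]
      field_simp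
    have h2 : (1 / 3 : ℝ) ^ β ≤ 1 := Real.rpow_le_one (by norm_num) (by norm_num) hβ.le
    calc n * (w * a ^ 2) ≤ (k : ℝ) ^ s * (w * a ^ 2) :=
          mul_le_mul_of_nonneg_right hnk (by positivity)
      _ = ε * (1 / 3 : ℝ) ^ β / 2 := h1
      _ ≤ 1 / 4 := by nlinarith [h.ε_le_eighth]
  refine le_minimaxRegret fun f _ => ?_
  obtain ⟨σ, hσ⟩ := h.exists_le_expectedRegret hm hw0 hw hxinj hκq hnw f
  have hwn := h.atomWeight_nonneg (J := Fin d → Fin k) m₀ m₁ hw0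
  have hprop := h.classProb_eq hm hw0 hw hκq σ
  have hfst : ((atomic (atomWeight m₀ m₁ ε δ b w W) x) ⊗ₘ κ σ).fst =
      atomic (atomWeight m₀ m₁ ε δ b w W) x := Measure.fst_compProd _ _
  refine ⟨(atomic (atomWeight m₀ m₁ ε δ b w W) x) ⊗ₘ κ σ, ⟨⟨?_, ?_, ?_, κ σ, hκM σ, ⟨?_⟩, hκH σ,
    h.marginCondition hm hβ hcβ hw0 hw hκq σ⟩, hprop⟩, le_trans ?_ hσ⟩
  · exact isProbabilityMeasure_compProd hwn (sum_atomWeight m₀ m₁ hw)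
  · rw [hfst, atomic_apply]
    simp [hx𝒳]
  · intro m
    rw [hprop]
    exact h.proportion_pos m₀ m
  · rw [hfst]
  · have e1 : W * a = ε * (1 / 3 : ℝ) ^ β * (k : ℝ) ^ (-γ) := by
      rw [hW, haβ, ha, mul_assoc, mul_assoc, ← Real.rpow_add hk0, mul_assoc]
      congr 3
      rw [hγ]
      ring
    rw [e1, mul_assoc, ← neg_div]
    calc _ ≤ ε * (1 / 3 : ℝ) ^ β / (16 * M) * (k : ℝ) ^ (-γ) :=
          mul_le_mul_of_nonneg_left hrate (by positivity)
      _ = _ := by ring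

end Main

end AMRegret

end

theorem theorem2 (d M : ℕ) (hM : 2 ≤ M)
    (𝒳 : Set (AMRegret.Feature d)) (h𝒳 : MeasurableSet 𝒳) (h𝒳' : (interior 𝒳).Nonempty)
    (α β cL cβ : ℝ) (hα : 0 < α) (hα1 : α ≤ 1) (hβ : 0 < β) (hcL : 0 < cL) (hcβ : 1 ≤ cβ)
    (hαβ : α * β < d) :
    -- the lower bound over the whole class
    (∃ c : ℝ, 0 < c ∧ ∀ n : ℕ, 1 ≤ n →
      ((c * (n : ℝ) ^ (-(α * (β + 1) / (2 * α + d))) : ℝ) : EReal) ≤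
        AMRegret.minimaxRegret (AMRegret.distClass M 𝒳 α β cL cβ) n) ∧
    -- it persists when the class proportions are fixed, independently of `n`
    (∃ p : Fin M → ℝ, (∀ m, 0 < p m) ∧ ∃ c : ℝ, 0 < c ∧ ∀ n : ℕ, 1 ≤ n →
      ((c * (n : ℝ) ^ (-(α * (β + 1) / (2 * α + d))) : ℝ) : EReal) ≤
        AMRegret.minimaxRegret
          {P ∈ AMRegret.distClass M 𝒳 α β cL cβ | ∀ m, AMRegret.classProb P m = p m} n) := by
  have hd : 1 ≤ d := by
    have : (0 : ℝ) < d := (mul_pos hα hβ).trans hαβ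
    exact_mod_cast this
  obtain ⟨p, hp, c, hc, h⟩ :=
    AMRegret.exists_proportion_minimaxRegret_ge d M hM hd h𝒳' hα hα1 hβ hcL hcβ
  exact ⟨⟨c, hc, fun n hn => (h n hn).trans
    (AMRegret.minimaxRegret_mono (Set.sep_subset _ _) n)⟩, p, hp, c, hc, h⟩
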